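/- Let $\Gamma$ be a finite simplicial graph with vertex set $V=\{v_1,\dots,v_n\}$, and let $A_\Gamma$ be the right-angled Artin group with generating set $V$ and defining relations $v_iv_j=v_jv_i$ for all adjacent $v_i,v_j$. An automorphism $\alpha$ of $A_\Gamma$ is called *pure palindromic* if, for each $v\in V$, the element $\alpha(v)$ can be represented by a word $u_1\cdots u_k$ on $V^{\pm1}$ of odd length that is identical, as a word, to its reverse $u_k\cdots u_1$ and whose middle letter is $v$ or $v^{-1}$. Let $\mathrm{PP\Pi A}_\Gamma\subseteq\mathrm{Aut}(A_\Gamma)$ be the set of pure palindromic automorphisms. For each $j$ let the *inversion* $\iota_j\in\mathrm{Aut}(A_\Gamma)$ be the automorphism with $v_j\mapsto v_j^{-1}$ that fixes every other vertex. For $i\neq j$ such that $v_j$ *dominates* $v_i$, that is, every vertex adjacent to $v_i$ is equal or adjacent to $v_j$, let the *dominated elementary palindromic automorphism* $P_{ij}\in\mathrm{Aut}(A_\Gamma)$ be the automorphism with $v_i\mapsto v_jv_iv_j$ that fixes every other vertex. **Theorem.** $\mathrm{PP\Pi A}_\Gamma$ is a subgroup of $\mathrm{Aut}(A_\Gamma)$,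 and it is generated by the finite set consisting of all the inversions $\iota_j$ and all the dominated elementary palindromic automorphisms $P_{ij}$. -/

import Mathlib

/-- The defining relators of the right-angled Artin group of a simple graph: the commutators of
pairs of adjacent vertices. -/
def raagRels {V : Type*} (Γ : SimpleGraph V) : Set (FreeGroup V) :=
  {r | ∃ u v : V, Γ.Adj u v ∧ r =
    FreeGroup.of u * FreeGroup.of v * (FreeGroup.of u)⁻¹ * (FreeGroup.of v)⁻¹}

/-- The right-angled Artin group of a simple graph, given by its standard presentation. -/
abbrev RAAG {V : Type*} (Γ : SimpleGraph V) : Type _ := PresentedGroup (raagRels Γ)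

namespace RAAG

variable {V : Type*} (Γ : SimpleGraph V)

/-- The generator attached to a vertex. -/
def gen (v : V) : RAAG Γ := PresentedGroup.of v

/-- The element represented by a word on `V^{±1}`. The letter `(v, true)` is `v` and the letter
`(v, false)` is `v⁻¹`. -/
def ofWord (w : List (V × Bool)) : RAAG Γ := PresentedGroup.mk (raagRels Γ) (FreeGroup.mk w)

theorem commute_gen {u v : V} (h : Γ.Adj u v) : Commute (gen Γ u) (gen Γ v) := by
  have h1 : PresentedGroup.mk (raagRels Γ)
      (FreeGroup.of u * FreeGroup.of v * (FreeGroup.of u)⁻¹ * (FreeGroup.of v)⁻¹) = 1 :=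
    PresentedGroup.one_of_mem ⟨u, v, h, rfl⟩
  simp only [map_mul, map_inv] at h1
  exact mul_inv_eq_iff_eq_mul.mp (mul_inv_eq_one.mp h1)

variable {Γ}

/-- The homomorphism determined by images of the vertices that commute for adjacent vertices. -/
def lift {G : Type*} [Group G] (f : V → G) (hf : ∀ u v, Γ.Adj u v → Commute (f u) (f v)) :
    RAAG Γ →* G :=
  PresentedGroup.toGroup (rels := raagRels Γ) (f := f) (by
    rintro r ⟨u, v, h, rfl⟩
    simp only [map_mul, map_inv, FreeGroup.lift_apply_of]
    exact mul_inv_eq_one.mpr (mul_inv_eq_iff_eq_mul.mpr (hf u v h)))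

@[simp] theorem lift_gen {G : Type*} [Group G] (f : V → G)
    (hf : ∀ u v, Γ.Adj u v → Commute (f u) (f v)) (v : V) : lift f hf (gen Γ v) = f v :=
  PresentedGroup.toGroup.of _

theorem hom_ext {G : Type*} [Group G] {f g : RAAG Γ →* G}
    (h : ∀ v, f (gen Γ v) = g (gen Γ v)) : f = g :=
  PresentedGroup.ext h

variable (Γ)

/-- `v` dominates `u`: the link of `u` is contained in the star of `v`. -/
def Dominates (v u : V) : Prop := Γ.neighborSet u ⊆ insert v (Γ.neighborSet v)

theorem commute_of_dominates {i j : V} (h : Dominates Γ j i) (w : V) (hw : Γ.Adj i w) :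
    Commute (gen Γ j) (gen Γ w) := by
  rcases h hw with rfl | h'
  · exact Commute.refl _
  · exact commute_gen Γ h'

variable [DecidableEq V]

/-- The endomorphism inverting the generator `v` and fixing the other generators. -/
def inversionHom (v : V) : RAAG Γ →* RAAG Γ :=
  lift (fun u => if u = v then (gen Γ u)⁻¹ else gen Γ u) (by
    intro a b hab
    have h := commute_gen Γ hab
    split_ifs
    · exact h.inv_inv
    · exact h.inv_left
    · exact h.inv_right
    · exact h)

theorem inversionHom_comp (v : V) :
    (inversionHom Γ v).comp (inversionHom Γ v) = MonoidHom.id _ := by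
  apply hom_ext
  intro u
  by_cases h : u = v <;> simp [inversionHom, h]

/-- The inversion at `v`: the automorphism with `v ↦ v⁻¹`, fixing every other vertex. -/
def inversion (v : V) : MulAut (RAAG Γ) :=
  MonoidHom.toMulEquiv (inversionHom Γ v) (inversionHom Γ v)
    (inversionHom_comp Γ v) (inversionHom_comp Γ v)

/-- For `x` commuting with all neighbours of `i`, the endomorphism sending the generator `i` to
`x * i * x` and fixing the other generators. -/
def palHom (i : V) (x : RAAG Γ) (hx : ∀ w, Γ.Adj i w → Commute x (gen Γ w)) :
    RAAG Γ →* RAAG Γ :=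
  lift (fun u => if u = i then x * gen Γ u * x else gen Γ u) (by
    intro a b hab
    have h := commute_gen Γ hab
    split_ifs with h1 h2 h2
    · exact absurd (h1.trans h2.symm) hab.ne
    · subst h1
      exact ((hx b hab).mul_left h).mul_left (hx b hab)
    · subst h2
      exact ((hx a hab.symm).symm.mul_right h).mul_right (hx a hab.symm).symm
    · exact h)

theorem palHom_comp {i j : V} (hij : i ≠ j) (h : Dominates Γ j i) :
    (palHom Γ i (gen Γ j)⁻¹ fun w hw => (commute_of_dominates Γ h w hw).inv_left).comp
      (palHom Γ i (gen Γ j) (commute_of_dominates Γ h)) = MonoidHom.id _ := by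
  apply hom_ext
  intro u
  by_cases hu : u = i <;> simp [palHom, hu, hij.symm, mul_assoc]

theorem palHom_comp' {i j : V} (hij : i ≠ j) (h : Dominates Γ j i) :
    (palHom Γ i (gen Γ j) (commute_of_dominates Γ h)).comp
      (palHom Γ i (gen Γ j)⁻¹ fun w hw => (commute_of_dominates Γ h w hw).inv_left) =
        MonoidHom.id _ := by
  apply hom_ext
  intro u
  by_cases hu : u = i <;> simp [palHom, hu, hij.symm, mul_assoc]

/-- The dominated elementary palindromic automorphism `P i j`, for distinct vertices `i`, `j` with
`i` dominated by `j`: it sends `i` to `j * i * j` and fixes every other vertex. -/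
def elementaryPalindromic (i j : V) (hij : i ≠ j) (h : Dominates Γ j i) : MulAut (RAAG Γ) :=
  MonoidHom.toMulEquiv (palHom Γ i (gen Γ j) (commute_of_dominates Γ h))
    (palHom Γ i (gen Γ j)⁻¹ fun w hw => (commute_of_dominates Γ h w hw).inv_left)
    (palHom_comp Γ hij h) (palHom_comp' Γ hij h)

theorem inversion_gen (v u : V) :
    inversion Γ v (gen Γ u) = if u = v then (gen Γ u)⁻¹ else gen Γ u := by
  change inversionHom Γ v (gen Γ u) = _
  simp [inversionHom]

theorem elementaryPalindromic_gen (i j : V) (hij : i ≠ j) (h : Dominates Γ j i) (u : V) :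
    elementaryPalindromic Γ i j hij h (gen Γ u) =
      if u = i then gen Γ j * gen Γ u * gen Γ j else gen Γ u := by
  change palHom Γ i (gen Γ j) (commute_of_dominates Γ h) (gen Γ u) = _
  simp [palHom]

/-- The set of all inversions. -/
def inversions : Set (MulAut (RAAG Γ)) := {α | ∃ v, α = inversion Γ v}

/-- The set of all dominated elementary palindromic automorphisms. -/
def elementaryPalindromics : Set (MulAut (RAAG Γ)) :=
  {α | ∃ (i j : V) (hij : i ≠ j) (h : Dominates Γ j i), α = elementaryPalindromic Γ i j hij h}

end RAAG

section

variable {V : Type*} (Γ : SimpleGraph V)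

/-- The set of palindromic automorphisms: each vertex is sent to an element represented by a word
on `V^{±1}` that is identical to its reverse. -/
def RAAG.palindromicAut : Set (MulAut (RAAG Γ)) :=
  {α | ∀ v : V, ∃ w : List (V × Bool), w.reverse = w ∧ RAAG.ofWord Γ w = α (RAAG.gen Γ v)}

/-- The set of pure palindromic automorphisms: the palindromic automorphisms that send each vertex
`v` to an element represented by a palindrome of odd length with middle letter `v` or `v⁻¹`. -/
def RAAG.purePalindromicAut : Set (MulAut (RAAG Γ)) :=
  {α | α ∈ RAAG.palindromicAut Γ ∧ ∀ v : V, ∃ (w p q : List (V × Bool)) (b : Bool),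
    w.reverse = w ∧ w = p ++ (v, b) :: q ∧ p.length = q.length ∧
      RAAG.ofWord Γ w = α (RAAG.gen Γ v)}

end

namespace RAAG

/-! ### Words, palindromes and the easy inclusion. -/

section Basic

variable {V : Type*} (Γ : SimpleGraph V)

/-! Write ι for the automorphism inverting every vertex. Reversing a word sends x to ι(x)⁻¹, so α is
pure palindromic when each α(v) has the form g v^{±1} ι(g)⁻¹. Multiplying α on the right by a
generator or its inverse inverts one vertex image or replaces it by y x y with ι(y) = y⁻¹, so the
generated group consists of pure palindromic automorphisms. Conversely, it suffices to bring a pure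
palindromic α to the identity by right multiplication with generators.

Such an α commutes with ι and is trivial on the abelianization mod 2. Commuting elements have
proportional exponents at two non-adjacent vertices (map to the Heisenberg group); this forces k to
dominate i whenever k has nonzero exponent in α(i) (`dominates_of_ex_ne_zero`). A Euclidean
reduction by column operations then kills the exponent of r in α(c) for all adjacent r, c
(`exists_clean`).

After that, α(i) lies in the subgroup on the vertices whose link contains lk(i). For k adjacent to
i, map the group to an HNN extension whose stable letter, the image of k, centralizes the subgroup
on lk(k). An element inverted by ι has a palindromic list of stable exponents, so its powers do not
cancel; comparing α(i) with α(k), which commutes with it, puts α(i) in the subgroup on lk(k)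
(`mem_parab_of_commute`).

Finally the link classes are fixed one at a time, larger links first. With ι adjoined, the subgroup
on the vertices whose link contains lk(i₀) maps faithfully to a free product: one factor is
generated by ι and the vertices of strictly larger link, and each v in the class of i₀ gives a
factor ⟨vι⟩ of order two. Palindromicity says that α conjugates vι by some W_v, and the generators
multiply W_v on the left. When the total length of the W_v is minimal, ping-pong shows that
surjectivity forces every W_v = 1 (`eq_one_of_mem_range`, `exists_fix_linkClass`). -/

theorem closure_range_gen : Subgroup.closure (Set.range (gen Γ)) = ⊤ :=
  PresentedGroup.closure_range_of (raagRels Γ)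

variable {Γ} in
theorem gen_induction {p : RAAG Γ → Prop} (hgen : ∀ v, p (gen Γ v)) (h1 : p 1)
    (hmul : ∀ x y, p x → p y → p (x * y)) (hinv : ∀ x, p x → p x⁻¹) (x : RAAG Γ) : p x := by
  have hx : x ∈ Subgroup.closure (Set.range (gen Γ)) := by simp [closure_range_gen]
  induction hx using Subgroup.closure_induction with
  | mem y hy => obtain ⟨v, rfl⟩ := hy; exact hgen v
  | one => exact h1
  | mul y z _ _ hy hz => exact hmul y z hy hz
  | inv y _ hy => exact hinv y hy

/-- The group element of a letter. -/
def letter (a : V × Bool) : RAAG Γ := if a.2 then gen Γ a.1 else (gen Γ a.1)⁻¹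

theorem ofWord_append (w₁ w₂ : List (V × Bool)) :
    ofWord Γ (w₁ ++ w₂) = ofWord Γ w₁ * ofWord Γ w₂ := by
  simp [ofWord, ← FreeGroup.mul_mk]

theorem ofWord_singleton (a : V × Bool) : ofWord Γ [a] = letter Γ a := by
  obtain ⟨v, b⟩ := a
  cases b
  · have : FreeGroup.mk [(v, false)] = (FreeGroup.of v)⁻¹ := rfl
    simp only [ofWord, letter, this, map_inv]; rfl
  · rfl

theorem ofWord_nil : ofWord Γ [] = 1 := map_one _

theorem ofWord_cons (a : V × Bool) (w : List (V × Bool)) :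
    ofWord Γ (a :: w) = letter Γ a * ofWord Γ w := by
  rw [← ofWord_singleton, ← ofWord_append, List.singleton_append]

theorem exists_ofWord (x : RAAG Γ) : ∃ w, ofWord Γ w = x := by
  obtain ⟨y, rfl⟩ := QuotientGroup.mk_surjective x
  classical
  exact ⟨y.toWord, by rw [ofWord, FreeGroup.mk_toWord]; rfl⟩

/-- The endomorphism inverting every generator. -/
def invAllHom : RAAG Γ →* RAAG Γ :=
  lift (fun v => (gen Γ v)⁻¹) fun _ _ h => (commute_gen Γ h).inv_inv

@[simp] theorem invAllHom_gen (v : V) : invAllHom Γ (gen Γ v) = (gen Γ v)⁻¹ := lift_gen _ _ _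

theorem invAllHom_comp : (invAllHom Γ).comp (invAllHom Γ) = MonoidHom.id _ :=
  hom_ext fun v => by simp

/-- The hyperelliptic involution: the automorphism inverting every generator. -/
def invAll : MulAut (RAAG Γ) :=
  MonoidHom.toMulEquiv (invAllHom Γ) (invAllHom Γ) (invAllHom_comp Γ) (invAllHom_comp Γ)

@[simp] theorem invAll_gen (v : V) : invAll Γ (gen Γ v) = (gen Γ v)⁻¹ := invAllHom_gen Γ v

@[simp] theorem invAll_invAll (x : RAAG Γ) : invAll Γ (invAll Γ x) = x :=
  DFunLike.congr_fun (invAllHom_comp Γ) x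

theorem ofWord_reverse (w : List (V × Bool)) :
    ofWord Γ w.reverse = (invAll Γ (ofWord Γ w))⁻¹ := by
  induction w with
  | nil => simp [ofWord_nil]
  | cons a w ih =>
    rw [List.reverse_cons, ofWord_append, ih, ofWord_singleton, ofWord_cons, map_mul, mul_inv_rev]
    congr 1
    obtain ⟨v, b⟩ := a
    cases b <;> simp [letter]

/-- The element is represented by a palindrome of odd length with middle letter `v` or `v⁻¹`. -/
def IsPalindromeAt (v : V) (x : RAAG Γ) : Prop :=
  ∃ g : RAAG Γ, x = g * gen Γ v * (invAll Γ g)⁻¹ ∨ x = g * (gen Γ v)⁻¹ * (invAll Γ g)⁻¹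

variable {Γ}

/-- The half of the palindrome before the middle letter represents g; the half after it is the
reversed word, which represents ι(g)⁻¹. -/
theorem isPalindromeAt_iff_exists_word {v : V} {x : RAAG Γ} :
    IsPalindromeAt Γ v x ↔ ∃ (w p q : List (V × Bool)) (b : Bool),
      w.reverse = w ∧ w = p ++ (v, b) :: q ∧ p.length = q.length ∧ ofWord Γ w = x := by
  constructor
  · rintro ⟨g, h⟩
    obtain ⟨p, rfl⟩ := exists_ofWord Γ g
    rcases h with rfl | rfl
    · refine ⟨_, p, p.reverse, true, ?_, rfl, by simp, ?_⟩
      · simp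
      · simp [ofWord_append, ofWord_cons, ofWord_reverse, letter, mul_assoc]
    · refine ⟨_, p, p.reverse, false, ?_, rfl, by simp, ?_⟩
      · simp
      · simp [ofWord_append, ofWord_cons, ofWord_reverse, letter, mul_assoc]
  · rintro ⟨w, p, q, b, hw, rfl, hl, rfl⟩
    have hq : q.reverse = p := by
      simp only [List.reverse_append, List.reverse_cons, List.append_assoc] at hw
      exact (List.append_inj hw (by simp [hl])).1
    refine ⟨ofWord Γ p, ?_⟩
    rw [← ofWord_reverse, ← hq, List.reverse_reverse, ofWord_append, ofWord_cons]
    cases b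
    · right; simp [letter, mul_assoc]
    · left; simp [letter, mul_assoc]

theorem mem_purePalindromicAut_iff {α : MulAut (RAAG Γ)} :
    α ∈ purePalindromicAut Γ ↔ ∀ v, IsPalindromeAt Γ v (α (gen Γ v)) := by
  constructor
  · intro h v
    exact isPalindromeAt_iff_exists_word.2 (h.2 v)
  · intro h
    refine ⟨fun v => ?_, fun v => isPalindromeAt_iff_exists_word.1 (h v)⟩
    obtain ⟨w, p, q, b, hw, -, -, hx⟩ := isPalindromeAt_iff_exists_word.1 (h v)
    exact ⟨w, hw, hx⟩

theorem IsPalindromeAt.invAll_eq {v : V} {x : RAAG Γ} (h : IsPalindromeAt Γ v x) :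
    invAll Γ x = x⁻¹ := by
  obtain ⟨g, rfl | rfl⟩ := h <;> simp [mul_assoc]

theorem IsPalindromeAt.mul_mul {v : V} {x y : RAAG Γ} (h : IsPalindromeAt Γ v x)
    (hy : invAll Γ y = y⁻¹) : IsPalindromeAt Γ v (y * x * y) := by
  obtain ⟨g, rfl | rfl⟩ := h
  · exact ⟨y * g, Or.inl (by simp [hy, mul_assoc])⟩
  · exact ⟨y * g, Or.inr (by simp [hy, mul_assoc])⟩

theorem IsPalindromeAt.inv {v : V} {x : RAAG Γ} (h : IsPalindromeAt Γ v x) :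
    IsPalindromeAt Γ v x⁻¹ := by
  obtain ⟨g, rfl | rfl⟩ := h
  · exact ⟨invAll Γ g, Or.inr (by simp [mul_assoc])⟩
  · exact ⟨invAll Γ g, Or.inl (by simp [mul_assoc])⟩

theorem isPalindromeAt_gen (v : V) : IsPalindromeAt Γ v (gen Γ v) := ⟨1, Or.inl (by simp)⟩

section Dec

variable [DecidableEq V]

theorem inversion_inv (v : V) : (inversion Γ v)⁻¹ = inversion Γ v := rfl

theorem elementaryPalindromic_inv_gen (i j : V) (hij : i ≠ j) (h : Dominates Γ j i) (u : V) :
    (elementaryPalindromic Γ i j hij h)⁻¹ (gen Γ u) =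
      if u = i then (gen Γ j)⁻¹ * gen Γ u * (gen Γ j)⁻¹ else gen Γ u := by
  change palHom Γ i (gen Γ j)⁻¹ (fun w hw => (commute_of_dominates Γ h w hw).inv_left)
    (gen Γ u) = _
  simp [palHom]

variable (Γ) in
/-- The subgroup generated by the inversions and the dominated elementary palindromic
automorphisms. -/
def palGroup : Subgroup (MulAut (RAAG Γ)) :=
  Subgroup.closure (inversions Γ ∪ elementaryPalindromics Γ)

theorem inversion_mem (v : V) : inversion Γ v ∈ palGroup Γ :=
  Subgroup.subset_closure (Or.inl ⟨v, rfl⟩)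

theorem elementaryPalindromic_mem (i j : V) (hij : i ≠ j) (h : Dominates Γ j i) :
    elementaryPalindromic Γ i j hij h ∈ palGroup Γ :=
  Subgroup.subset_closure (Or.inr ⟨i, j, hij, h, rfl⟩)

theorem mul_inversion_gen (α : MulAut (RAAG Γ)) (v u : V) :
    (α * inversion Γ v) (gen Γ u) = if u = v then (α (gen Γ u))⁻¹ else α (gen Γ u) := by
  rw [MulAut.mul_apply, inversion_gen]
  split_ifs <;> simp

theorem mul_elementaryPalindromic_gen (α : MulAut (RAAG Γ)) (i j : V) (hij : i ≠ j)
    (h : Dominates Γ j i) (u : V) :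
    (α * elementaryPalindromic Γ i j hij h) (gen Γ u) =
      if u = i then α (gen Γ j) * α (gen Γ u) * α (gen Γ j) else α (gen Γ u) := by
  rw [MulAut.mul_apply, elementaryPalindromic_gen]
  split_ifs <;> simp

theorem mul_elementaryPalindromic_inv_gen (α : MulAut (RAAG Γ)) (i j : V) (hij : i ≠ j)
    (h : Dominates Γ j i) (u : V) :
    (α * (elementaryPalindromic Γ i j hij h)⁻¹) (gen Γ u) =
      if u = i then (α (gen Γ j))⁻¹ * α (gen Γ u) * (α (gen Γ j))⁻¹ else α (gen Γ u) := by
  rw [MulAut.mul_apply, elementaryPalindromic_inv_gen]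
  split_ifs <;> simp

/-- Multiplying on the right by one generator at a time changes a single vertex image, so closure of
the whole palindromic set under composition is never needed. -/
theorem mul_mem_purePalindromicAut {α γ : MulAut (RAAG Γ)} (hα : α ∈ purePalindromicAut Γ)
    (hγ : γ ∈ palGroup Γ) : α * γ ∈ purePalindromicAut Γ := by
  induction hγ using Subgroup.closure_induction_right with
  | one => simpa using hα
  | mul_right x _ y hy ih =>
    rw [← mul_assoc]
    generalize α * x = β at ih
    rw [mem_purePalindromicAut_iff] at ih ⊢
    intro u
    rcases hy with ⟨v, rfl⟩ | ⟨i, j, hij, h, rfl⟩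
    · rw [mul_inversion_gen]
      split_ifs
      · exact (ih u).inv
      · exact ih u
    · rw [mul_elementaryPalindromic_gen]
      split_ifs
      · exact (ih u).mul_mul (ih j).invAll_eq
      · exact ih u
  | mul_inv_cancel x _ y hy ih =>
    rw [← mul_assoc]
    generalize α * x = β at ih
    rw [mem_purePalindromicAut_iff] at ih ⊢
    intro u
    rcases hy with ⟨v, rfl⟩ | ⟨i, j, hij, h, rfl⟩
    · rw [inversion_inv, mul_inversion_gen]
      split_ifs
      · exact (ih u).inv
      · exact ih u
    · rw [mul_elementaryPalindromic_inv_gen]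
      split_ifs
      · exact (ih u).mul_mul (by rw [map_inv, (ih j).invAll_eq])
      · exact ih u

theorem palGroup_subset : (palGroup Γ : Set (MulAut (RAAG Γ))) ⊆ purePalindromicAut Γ := by
  intro γ hγ
  have h1 : (1 : MulAut (RAAG Γ)) ∈ purePalindromicAut Γ :=
    mem_purePalindromicAut_iff.2 fun v => isPalindromeAt_gen v
  simpa using mul_mem_purePalindromicAut h1 hγ

theorem finite_generators [Finite V] :
    (inversions Γ ∪ elementaryPalindromics Γ).Finite := by
  refine Set.Finite.union ?_ ?_
  · refine (Set.finite_range (inversion Γ)).subset ?_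
    rintro _ ⟨v, rfl⟩
    exact ⟨v, rfl⟩
  · have : (⋃ (i : V) (j : V) (hij : i ≠ j) (h : Dominates Γ j i),
        {elementaryPalindromic Γ i j hij h}).Finite :=
      Set.finite_iUnion fun i => Set.finite_iUnion fun j => Set.finite_iUnion fun hij =>
        Set.finite_iUnion fun h => Set.finite_singleton _
    refine this.subset ?_
    rintro _ ⟨i, j, hij, h, rfl⟩
    simp only [Set.mem_iUnion]
    exact ⟨i, j, hij, h, rfl⟩

end Dec

end Basic

/-! ### Parabolic subgroups as fixed points of retractions. -/

section Parabolic

variable {V : Type*} (Γ : SimpleGraph V)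

open Classical in
/-- The retraction killing the generators outside `S`. -/
noncomputable def ret (S : Set V) : RAAG Γ →* RAAG Γ :=
  lift (fun v => if v ∈ S then gen Γ v else 1) fun u v h => by
    split_ifs
    · exact commute_gen Γ h
    · exact Commute.one_right _
    · exact Commute.one_left _
    · exact Commute.one_left _

variable {Γ}

theorem ret_gen {S : Set V} {v : V} (h : v ∈ S) : ret Γ S (gen Γ v) = gen Γ v := by
  simp [ret, h]

theorem ret_gen_of_notMem {S : Set V} {v : V} (h : v ∉ S) : ret Γ S (gen Γ v) = 1 := by
  simp [ret, h]

theorem ret_ret (S T : Set V) (x : RAAG Γ) : ret Γ S (ret Γ T x) = ret Γ (S ∩ T) x := by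
  refine DFunLike.congr_fun (f := (ret Γ S).comp (ret Γ T)) (hom_ext fun v => ?_) x
  by_cases hS : v ∈ S <;> by_cases hT : v ∈ T <;>
    simp [ret_gen, ret_gen_of_notMem, hS, hT]

variable (Γ) in
/-- The subgroup generated by the vertices of `S`, described as the fixed points of the
retraction onto it. -/
noncomputable def parab (S : Set V) : Subgroup (RAAG Γ) :=
  (ret Γ S).eqLocus (MonoidHom.id _)

theorem mem_parab {S : Set V} {x : RAAG Γ} : x ∈ parab Γ S ↔ ret Γ S x = x := Iff.rfl

theorem gen_mem_parab {S : Set V} {v : V} (h : v ∈ S) : gen Γ v ∈ parab Γ S := ret_gen h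

theorem parab_mono {S T : Set V} (h : S ⊆ T) : parab Γ S ≤ parab Γ T := by
  intro x hx
  rw [mem_parab] at hx ⊢
  rw [← hx, ret_ret, Set.inter_eq_self_of_subset_right h]

theorem eq_of_mem_parab {G : Type*} [Group G] {f g : RAAG Γ →* G} {S : Set V}
    (h : ∀ v ∈ S, f (gen Γ v) = g (gen Γ v)) {x : RAAG Γ} (hx : x ∈ parab Γ S) : f x = g x := by
  rw [← mem_parab.1 hx]
  refine DFunLike.congr_fun (f := f.comp (ret Γ S)) (g := g.comp (ret Γ S)) (hom_ext fun v => ?_) x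
  by_cases hS : v ∈ S
  · simp [ret_gen, hS, h]
  · simp [ret_gen_of_notMem, hS]

theorem map_mem_of_mem_parab {G : Type*} [Group G] {f : RAAG Γ →* G} {S : Set V} {H : Subgroup G}
    (h : ∀ v ∈ S, f (gen Γ v) ∈ H) {x : RAAG Γ} (hx : x ∈ parab Γ S) : f x ∈ H := by
  rw [← mem_parab.1 hx]
  clear hx
  induction x using gen_induction with
  | hgen v =>
    by_cases hS : v ∈ S
    · simp [ret_gen, hS, h]
    · simp [ret_gen_of_notMem, hS]
  | h1 => simp
  | hmul x y ihx ihy => simpa using H.mul_mem ihx ihy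
  | hinv x ihx => simpa using H.inv_mem ihx

/-- Retractions compose by intersecting vertex sets, so the missing vertices can be removed one by
one. -/
theorem mem_parab_of_forall [Finite V] {S : Set V} {x : RAAG Γ}
    (h : ∀ u ∉ S, x ∈ parab Γ {u}ᶜ) : x ∈ parab Γ S := by
  have key : ∀ T : Set V, T.Finite → T ⊆ Sᶜ → x ∈ parab Γ Tᶜ := by
    intro T hT
    induction T, hT using Set.Finite.induction_on with
    | empty =>
      intro _
      rw [mem_parab]
      refine DFunLike.congr_fun (g := MonoidHom.id _) (hom_ext fun v => ?_) x
      simp [ret_gen]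
    | @insert a T _ _ ih =>
      intro hT
      have h1 := ih ((Set.subset_insert _ _).trans hT)
      have h2 := h a (hT (Set.mem_insert _ _))
      rw [mem_parab] at h1 h2 ⊢
      rw [Set.insert_eq, Set.compl_union, ← ret_ret, h1, h2]
  simpa using key Sᶜ (Set.toFinite _) subset_rfl

theorem invAll_mem_parab {S : Set V} {x : RAAG Γ} (hx : x ∈ parab Γ S) :
    invAll Γ x ∈ parab Γ S :=
  map_mem_of_mem_parab (f := (invAll Γ).toMonoidHom)
    (fun v hv => by simpa using gen_mem_parab hv) hx

end Parabolic

/-! ### Exponent sums and the Heisenberg representation. -/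

section Exponent

variable {V : Type*} (Γ : SimpleGraph V)

open Classical in
/-- The exponent sum of a vertex, as a homomorphism. -/
noncomputable def exHom (k : V) : RAAG Γ →* Multiplicative ℤ :=
  lift (fun v => if v = k then Multiplicative.ofAdd 1 else 1) fun _ _ _ => Commute.all _ _

/-- The exponent sum of a vertex. -/
noncomputable def ex (k : V) (x : RAAG Γ) : ℤ := (exHom Γ k x).toAdd

variable {Γ}

@[simp] theorem ex_one (k : V) : ex Γ k 1 = 0 := by simp [ex]
@[simp] theorem ex_mul (k : V) (x y : RAAG Γ) : ex Γ k (x * y) = ex Γ k x + ex Γ k y := by simp [ex]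
@[simp] theorem ex_inv (k : V) (x : RAAG Γ) : ex Γ k x⁻¹ = -ex Γ k x := by simp [ex]
theorem ex_pow (k : V) (x : RAAG Γ) (n : ℕ) : ex Γ k (x ^ n) = n * ex Γ k x := by simp [ex]

theorem ex_gen_self (k : V) : ex Γ k (gen Γ k) = 1 := by simp [ex, exHom]
theorem ex_gen_of_ne {k v : V} (h : v ≠ k) : ex Γ k (gen Γ v) = 0 := by simp [ex, exHom, h]

@[simp] theorem ex_invAll (k : V) (x : RAAG Γ) : ex Γ k (invAll Γ x) = -ex Γ k x := by
  induction x using gen_induction with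
  | hgen v => simp
  | h1 => simp
  | hmul x y hx hy => simp [hx, hy]; ring
  | hinv x hx => simp [hx]

theorem IsPalindromeAt.odd_ex {v : V} {x : RAAG Γ} (h : IsPalindromeAt Γ v x) :
    Odd (ex Γ v x) := by
  obtain ⟨g, rfl | rfl⟩ := h
  · exact ⟨ex Γ v g, by simp [ex_gen_self]; ring⟩
  · exact ⟨ex Γ v g - 1, by simp [ex_gen_self]; ring⟩

theorem IsPalindromeAt.even_ex {v k : V} (hk : v ≠ k) {x : RAAG Γ} (h : IsPalindromeAt Γ v x) :
    Even (ex Γ k x) := by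
  obtain ⟨g, rfl | rfl⟩ := h <;> exact ⟨ex Γ k g, by simp [ex_gen_of_ne hk]⟩

theorem ex_map [Fintype V] (α : MulAut (RAAG Γ)) (k : V) (x : RAAG Γ) :
    ex Γ k (α x) = ∑ j, ex Γ k (α (gen Γ j)) * ex Γ j x := by
  classical
  induction x using gen_induction with
  | hgen v =>
    rw [Finset.sum_eq_single v]
    · simp [ex_gen_self]
    · intro j _ hj; simp [ex_gen_of_ne hj.symm]
    · simp
  | h1 => simp
  | hmul x y hx hy => simp [hx, hy, mul_add, Finset.sum_add_distrib]
  | hinv x hx => simp [hx]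

/-- The integral Heisenberg group acts on ℤ³ by shifts: a moves the first coordinate, b moves the
second and adds the first to the third. All other vertices act trivially. -/
theorem exists_perm_of_not_adj {a b : V} (hab : a ≠ b) (h : ¬ Γ.Adj a b) :
    ∃ f : RAAG Γ →* Equiv.Perm (ℤ × ℤ × ℤ), ∀ x, ∃ c : ℤ, ∀ p q s,
      f x (p, q, s) = (p + ex Γ a x, q + ex Γ b x, s + p * ex Γ b x + c) := by
  classical
  let A : Equiv.Perm (ℤ × ℤ × ℤ) :=
    ⟨fun z => (z.1 + 1, z.2), fun z => (z.1 - 1, z.2), fun z => by simp, fun z => by simp⟩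
  let B : Equiv.Perm (ℤ × ℤ × ℤ) :=
    ⟨fun z => (z.1, z.2.1 + 1, z.2.2 + z.1), fun z => (z.1, z.2.1 - 1, z.2.2 - z.1),
      fun z => by simp, fun z => by simp⟩
  refine ⟨lift (fun v => if v = a then A else if v = b then B else 1) ?_, ?_⟩
  · intro u v huv
    have h1 : ¬ (u = a ∧ v = b) := by rintro ⟨rfl, rfl⟩; exact h huv
    have h2 : ¬ (u = b ∧ v = a) := by rintro ⟨rfl, rfl⟩; exact h huv.symm
    split_ifs <;> first | exact Commute.one_left _ | exact Commute.one_right _ |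
      exact Commute.refl _ | simp_all
  · intro x
    induction x using gen_induction with
    | hgen v =>
      refine ⟨0, fun p q s => ?_⟩
      rw [lift_gen]
      by_cases ha : v = a
      · subst ha; simp [A, ex_gen_self, ex_gen_of_ne hab]
      · by_cases hb : v = b
        · subst hb; simp [B, ex_gen_self, ex_gen_of_ne hab.symm, ha]
        · simp [ha, hb, ex_gen_of_ne ha, ex_gen_of_ne hb]
    | h1 => exact ⟨0, fun p q s => by simp⟩
    | hmul x y hx hy =>
      obtain ⟨c, hc⟩ := hx
      obtain ⟨d, hd⟩ := hy
      refine ⟨c + d + ex Γ a y * ex Γ b x, fun p q s => ?_⟩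
      rw [map_mul, Equiv.Perm.mul_apply, hd, hc]
      simp only [ex_mul, Prod.mk.injEq]
      refine ⟨by ring, by ring, by ring⟩
    | hinv x hx =>
      obtain ⟨c, hc⟩ := hx
      refine ⟨ex Γ a x * ex Γ b x - c, fun p q s => ?_⟩
      rw [map_inv, Equiv.Perm.inv_eq_iff_eq, hc]
      simp only [ex_inv, Prod.mk.injEq]
      refine ⟨by ring, by ring, by ring⟩

/-- Compare the third coordinates of xy and yx at the origin: the constants agree and the cross
terms remain. -/
theorem ex_mul_ex_of_commute {a b : V} (hab : a ≠ b) (h : ¬ Γ.Adj a b) {x y : RAAG Γ}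
    (hxy : Commute x y) : ex Γ a x * ex Γ b y = ex Γ b x * ex Γ a y := by
  obtain ⟨f, hf⟩ := exists_perm_of_not_adj hab h
  obtain ⟨c, hc⟩ := hf x
  obtain ⟨d, hd⟩ := hf y
  have h1 : f (x * y) (0, 0, 0) = f (y * x) (0, 0, 0) := by rw [hxy.eq]
  rw [map_mul, map_mul, Equiv.Perm.mul_apply, Equiv.Perm.mul_apply, hc, hd, hc, hd] at h1
  simp only [Prod.mk.injEq] at h1
  linarith [h1.2.2]

end Exponent

end RAAG

namespace RAAG

/-! ### The level two group and domination. -/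

section LevelTwo

variable {V : Type*} (Γ : SimpleGraph V)

/-- The automorphisms that commute with the hyperelliptic involution and act trivially on the
abelianization modulo two. -/
def levelTwo : Subgroup (MulAut (RAAG Γ)) where
  carrier := {α | (∀ x, α (invAll Γ x) = invAll Γ (α x)) ∧
    ∀ k x, ((ex Γ k (α x) : ℤ) : ZMod 2) = (ex Γ k x : ℤ)}
  one_mem' := ⟨fun _ => rfl, fun _ _ => rfl⟩
  mul_mem' := fun {α β} hα hβ =>
    ⟨fun x => by rw [MulAut.mul_apply, hβ.1, hα.1]; rfl,
      fun k x => by rw [MulAut.mul_apply, hα.2, hβ.2]⟩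
  inv_mem' := fun {α} hα =>
    ⟨fun x => α.injective (by rw [hα.1, MulAut.apply_inv_self, MulAut.apply_inv_self]),
      fun k x => by rw [← hα.2, MulAut.apply_inv_self]⟩

variable {Γ}

theorem purePalindromicAut_subset_levelTwo {α : MulAut (RAAG Γ)}
    (hα : α ∈ purePalindromicAut Γ) : α ∈ levelTwo Γ := by
  rw [mem_purePalindromicAut_iff] at hα
  refine ⟨fun x => ?_, fun k x => ?_⟩
  · refine DFunLike.congr_fun (f := α.toMonoidHom.comp (invAll Γ).toMonoidHom)
      (g := (invAll Γ).toMonoidHom.comp α.toMonoidHom) (hom_ext fun v => ?_) x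
    simp [(hα v).invAll_eq]
  · induction x using gen_induction with
    | hgen v =>
      by_cases hv : v = k
      · subst hv
        rw [ex_gen_self]
        have := (hα v).odd_ex
        rw [Int.cast_one]
        exact (ZMod.intCast_eq_one_iff_odd).2 this
      · rw [ex_gen_of_ne hv, Int.cast_zero]
        exact ZMod.intCast_eq_zero_iff_even.2 ((hα v).even_ex hv)
    | h1 => simp
    | hmul x y hx hy => simp [hx, hy]
    | hinv x hx => simp [hx]

theorem levelTwo.odd_ex {α : MulAut (RAAG Γ)} (hα : α ∈ levelTwo Γ) (i : V) :
    Odd (ex Γ i (α (gen Γ i))) := by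
  rw [← ZMod.intCast_eq_one_iff_odd, hα.2, ex_gen_self, Int.cast_one]

theorem levelTwo.even_ex {α : MulAut (RAAG Γ)} (hα : α ∈ levelTwo Γ) {k i : V} (h : i ≠ k) :
    Even (ex Γ k (α (gen Γ i))) := by
  rw [← ZMod.intCast_eq_zero_iff_even, hα.2, ex_gen_of_ne h, Int.cast_zero]

theorem levelTwo.invAll_eq {α : MulAut (RAAG Γ)} (hα : α ∈ levelTwo Γ) (i : V) :
    invAll Γ (α (gen Γ i)) = (α (gen Γ i))⁻¹ := by
  rw [← hα.1, invAll_gen, map_inv]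

/-- An integral combination of the columns of a matrix that is the identity modulo two is
a nonzero multiple of a given basis vector. -/
theorem exists_mulVec_eq_of_odd_diag {n : Type*} [Fintype n] [DecidableEq n] (Z : Matrix n n ℤ)
    (hZ : ∀ i j, ((Z i j : ℤ) : ZMod 2) = if i = j then 1 else 0) (q : n) :
    ∃ (c : n → ℤ) (d : ℤ), d ≠ 0 ∧ ∀ p, ∑ k, Z p k * c k = if p = q then d else 0 := by
  have hdet : ((Z.det : ℤ) : ZMod 2) = 1 := by
    have h1 := (Int.castRingHom (ZMod 2)).map_det Z
    have h2 : (Int.castRingHom (ZMod 2)).mapMatrix Z = 1 := by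
      ext i j; simp [hZ, Matrix.one_apply]
    rw [h2, Matrix.det_one] at h1
    simpa using h1
  -- Column q of the adjugate, with d = det Z; the determinant is odd, hence nonzero.
  refine ⟨fun k => Z.adjugate k q, Z.det, ?_, fun p => ?_⟩
  · intro h; rw [h] at hdet; simp at hdet
  · have := congrFun (congrFun (Matrix.mul_adjugate Z) p) q
    rw [Matrix.mul_apply] at this
    rw [this]; simp [Matrix.one_apply]

/-- If q ∈ lk(i) lies outside the star of k, the images of i and of each neighbour j of i have
proportional exponents at k and q. A combination of the columns of the neighbours, corrected by
column i, is nonzero at q and zero at k, and this forces the entry (k, i) to vanish. -/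
theorem dominates_of_ex_ne_zero [Finite V] {α : MulAut (RAAG Γ)} (hα : α ∈ levelTwo Γ) {k i : V}
    (h : ex Γ k (α (gen Γ i)) ≠ 0) : Dominates Γ k i := by
  classical
  have : Fintype V := Fintype.ofFinite V
  intro q hq
  by_contra hcon
  rw [Set.mem_insert_iff, not_or] at hcon
  obtain ⟨hqk, hadj⟩ := hcon
  change ¬ Γ.Adj k q at hadj
  apply h
  let M : V → V → ℤ := fun a b => ex Γ a (α (gen Γ b))
  have hrel : ∀ j, Γ.Adj i j → ∀ a b, a ≠ b → ¬ Γ.Adj a b → M a i * M b j = M b i * M a j := by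
    intro j hj a b hab hnadj
    exact ex_mul_ex_of_commute hab hnadj ((commute_gen Γ hj).map α)
  have hodd : Odd (M i i) := levelTwo.odd_ex hα i
  -- The 2 × 2 minors with the odd pivot M i i: column i is eliminated from the columns of the
  -- neighbours. Mod 2 this is the identity.
  let Z : Matrix (Γ.neighborSet i) (Γ.neighborSet i) ℤ :=
    fun p j => M i i * M p j - M i j * M p i
  obtain ⟨c, d, hd, hc⟩ := exists_mulVec_eq_of_odd_diag Z (by
    intro p j
    have e1 : ((M i j : ℤ) : ZMod 2) = 0 :=
      ZMod.intCast_eq_zero_iff_even.2 (levelTwo.even_ex hα (Γ.ne_of_adj j.2).symm)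
    have e2 : ((M i i : ℤ) : ZMod 2) = 1 := ZMod.intCast_eq_one_iff_odd.2 hodd
    have e3 : ((M p j : ℤ) : ZMod 2) = if p = j then 1 else 0 := by
      split_ifs with hpj
      · rw [hpj]; exact ZMod.intCast_eq_one_iff_odd.2 (levelTwo.odd_ex hα _)
      · exact ZMod.intCast_eq_zero_iff_even.2
          (levelTwo.even_ex hα (fun h => hpj (Subtype.ext h.symm)))
    simp [Z, e1, e2, e3]) ⟨q, hq⟩
  let z : V → ℤ := fun p => ∑ j : Γ.neighborSet i, (M i i * M p j - M i j * M p i) * c j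
  have hzq : z q = d := by simpa using hc ⟨q, hq⟩
  -- Either k = i, or k is a neighbour of i other than q, or k is not adjacent to i and each minor
  -- vanishes by commutation.
  have hzk : z k = 0 := by
    by_cases hki : k = i
    · subst hki; exact Finset.sum_eq_zero fun j _ => by ring
    by_cases hk : Γ.Adj i k
    · have := hc ⟨k, hk⟩
      rw [if_neg (fun h => hqk (congrArg Subtype.val h).symm)] at this
      exact this
    · refine Finset.sum_eq_zero fun j _ => ?_
      rw [hrel j j.2 i k (Ne.symm hki) hk]; ring
  have hcomb : M k i * z q = M q i * z k := by
    simp only [z, Finset.mul_sum]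
    refine Finset.sum_congr rfl fun j _ => ?_
    linear_combination (M i i * c j) * hrel j j.2 k q (Ne.symm hqk) hadj
  rw [hzk, hzq, mul_zero] at hcomb
  exact (mul_eq_zero.1 hcomb).resolve_right hd

end LevelTwo

/-! ### Euclidean reduction of the abelianization. -/

section Clean

variable {V : Type*} {Γ : SimpleGraph V}

/-- As c ∈ lk(r), either r' = c or r' is adjacent to c; in the second case r' lies in lk(c), hence
in the star of r. -/
theorem Dominates.adj_of_dominates {r c r' : V} (h : Dominates Γ r c) (hcr : Γ.Adj c r)
    (hr' : Dominates Γ r' r) (hne : r' ≠ r) : Γ.Adj r r' := by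
  by_cases hrc : r' = c
  · subst hrc; exact hcr.symm
  have h1 : c ∈ insert r' (Γ.neighborSet r') := hr' hcr.symm
  have h2 : Γ.Adj r' c := h1.resolve_left (fun h => hrc h.symm)
  have h3 : r' ∈ insert r (Γ.neighborSet r) := h h2.symm
  exact h3.resolve_left hne

variable (Γ) in
/-- The row `r` of the abelianization of `α` vanishes at the neighbours of `r`. -/
def CleanRow (α : MulAut (RAAG Γ)) (r : V) : Prop :=
  ∀ c, Γ.Adj r c → ex Γ r (α (gen Γ c)) = 0

theorem palGroup_le_levelTwo [DecidableEq V] : palGroup Γ ≤ levelTwo Γ := fun _ h =>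
  purePalindromicAut_subset_levelTwo (palGroup_subset h)

/-- A column operation changes one column of the abelianization. -/
theorem exists_column_operation [DecidableEq V] (α : MulAut (RAAG Γ)) {i j : V} (hij : i ≠ j)
    (h : Dominates Γ j i) (ε : ℤ) (hε : ε = 1 ∨ ε = -1) :
    ∃ γ ∈ palGroup Γ, ∀ k u, ex Γ k ((α * γ) (gen Γ u)) =
      if u = i then ex Γ k (α (gen Γ i)) + 2 * ε * ex Γ k (α (gen Γ j))
      else ex Γ k (α (gen Γ u)) := by
  rcases hε with rfl | rfl
  · refine ⟨_, elementaryPalindromic_mem i j hij h, fun k u => ?_⟩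
    rw [mul_elementaryPalindromic_gen]
    split_ifs with hu
    · subst hu; simp; ring
    · rfl
  · refine ⟨_, inv_mem (elementaryPalindromic_mem i j hij h), fun k u => ?_⟩
    rw [mul_elementaryPalindromic_inv_gen]
    split_ifs with hu
    · subst hu; simp; ring
    · rfl

/-- Give 2εa the sign opposite to b; as 0 < |a| < |b|, the sum lands strictly between -|b| and |b|.
-/
theorem exists_sign_natAbs_lt {a b : ℤ} (ha : a ≠ 0) (h : a.natAbs < b.natAbs) :
    ∃ ε : ℤ, (ε = 1 ∨ ε = -1) ∧ (b + 2 * ε * a).natAbs < b.natAbs := by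
  rcases le_or_gt 0 (a * b) with hab | hab
  · refine ⟨-1, Or.inr rfl, ?_⟩
    rcases lt_or_gt_of_ne ha with h1 | h1
    · have : b ≤ 0 := by by_contra! hb; nlinarith
      omega
    · have : 0 ≤ b := by by_contra! hb; nlinarith
      omega
  · refine ⟨1, Or.inl rfl, ?_⟩
    rcases lt_or_gt_of_ne ha with h1 | h1
    · have : 0 ≤ b := by by_contra! hb; nlinarith
      omega
    · have : b ≤ 0 := by by_contra! hb; nlinarith
      omega

/-- If `r` dominates a neighbour and the entries of row `r` vanish at the neighbours outside `R`
that dominate `r`, where the rows in `R` are clean, then the diagonal entry is a unit. -/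
theorem natAbs_ex_diag_eq_one [Finite V] {α : MulAut (RAAG Γ)} (hα : α ∈ levelTwo Γ) {R : Set V}
    (hR : ∀ r ∈ R, CleanRow Γ α r) {r c₀ : V} (hc₀ : Γ.Adj c₀ r) (hdom : Dominates Γ r c₀)
    (hrow : ∀ c, Γ.Adj r c → Dominates Γ c r → c ∉ R → ex Γ r (α (gen Γ c)) = 0) :
    (ex Γ r (α (gen Γ r))).natAbs = 1 := by
  classical
  have : Fintype V := Fintype.ofFinite V
  -- Column r of the inverse matrix. The plan is to show that row r of α meets it only on the
  -- diagonal, so that the diagonal entry is a factor of 1.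
  let x : V → ℤ := fun j => ex Γ j (α⁻¹ (gen Γ r))
  have hprod : ∀ k, ∑ j, ex Γ k (α (gen Γ j)) * x j = ex Γ k (gen Γ r) := by
    intro k
    rw [← ex_map, MulAut.apply_inv_self]
  have hx : ∀ j, x j ≠ 0 → j = r ∨ (Γ.Adj r j ∧ Dominates Γ j r) := by
    intro j hj
    have h1 : Dominates Γ j r := dominates_of_ex_ne_zero (inv_mem hα) hj
    by_cases hjr : j = r
    · exact Or.inl hjr
    · exact Or.inr ⟨hdom.adj_of_dominates hc₀ h1 hjr, h1⟩
  -- In row j, cleanness removes every term but the diagonal one, so M j j * x j = 0 with M j j odd.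
  have hxR : ∀ j ∈ R, j ≠ r → x j = 0 := by
    intro j hj hjr
    by_contra hne
    obtain ⟨hadj, hdj⟩ := (hx j hne).resolve_left hjr
    have h1 := hprod j
    rw [Finset.sum_eq_single j, ex_gen_of_ne hjr.symm] at h1
    · rcases mul_eq_zero.1 h1 with h2 | h2
      · have := levelTwo.odd_ex hα j
        rw [h2] at this
        exact absurd this (by decide)
      · exact hne h2
    · intro l _ hlj
      by_cases hl : x l = 0
      · simp [hl]
      · have : Γ.Adj j l := by
          rcases hx l hl with rfl | ⟨h2, h3⟩
          · exact hadj.symm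
          · exact (hdj h2).resolve_left hlj
        rw [hR j hj l this, zero_mul]
    · simp
  have h1 := hprod r
  rw [Finset.sum_eq_single r, ex_gen_self] at h1
  · exact Int.isUnit_iff_natAbs_eq.1 (IsUnit.of_mul_eq_one _ h1)
  · intro j _ hjr
    by_cases hj : x j = 0
    · simp [hj]
    · obtain ⟨h2, h3⟩ := (hx j hj).resolve_left hjr
      rw [hrow j h2 h3 (fun hjR => hj (hxR j hjR hjr)), zero_mul]
  · simp

/-- Minimize the sum of the absolute values of row r over the star of r, among the modifications
keeping the rows of R clean. Neighbour entries are then smaller than the diagonal one. If a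
neighbour entry were nonzero, r would dominate that neighbour, so the diagonal entry would be ±1,
leaving no room. -/
theorem exists_cleanRow_insert [Finite V] [DecidableEq V] {R : Set V} (r : V)
    {α : MulAut (RAAG Γ)} (hα : α ∈ levelTwo Γ) (hR : ∀ s ∈ R, CleanRow Γ α s) :
    ∃ γ ∈ palGroup Γ, ∀ s ∈ insert r R, CleanRow Γ (α * γ) s := by
  classical
  have : Fintype V := Fintype.ofFinite V
  by_cases hrR : r ∈ R
  · exact ⟨1, one_mem _, by simpa [hrR] using hR⟩
  let T : Finset V := Finset.univ.filter fun c => c = r ∨ Γ.Adj r c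
  let m : MulAut (RAAG Γ) → ℕ := fun γ => ∑ c ∈ T, (ex Γ r ((α * γ) (gen Γ c))).natAbs
  let Q : Set (MulAut (RAAG Γ)) := {γ | γ ∈ palGroup Γ ∧ ∀ s ∈ R, CleanRow Γ (α * γ) s}
  have hQ : Q.Nonempty := ⟨1, one_mem _, by simpa using hR⟩
  obtain ⟨γ, ⟨hγ, hγR⟩, hmin⟩ := WellFounded.has_min (measure m).wf Q hQ
  refine ⟨γ, hγ, ?_⟩
  have hβ : α * γ ∈ levelTwo Γ := mul_mem hα (palGroup_le_levelTwo hγ)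
  set β := α * γ with hβdef
  -- an admissible column operation cannot decrease the absolute value of an entry of the row
  have hop : ∀ i j, i ∈ T → i ≠ j → Dominates Γ j i →
      (∀ s ∈ R, Γ.Adj s i → ex Γ s (β (gen Γ j)) = 0) → ex Γ r (β (gen Γ j)) ≠ 0 →
      (ex Γ r (β (gen Γ i))).natAbs ≤ (ex Γ r (β (gen Γ j))).natAbs := by
    intro i j hi hij hdom hs h0
    by_contra! hlt
    obtain ⟨ε, hε, hlt'⟩ := exists_sign_natAbs_lt h0 hlt
    obtain ⟨δ, hδ, hδe⟩ := exists_column_operation β hij hdom ε hε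
    refine hmin (γ * δ) ⟨mul_mem hγ hδ, ?_⟩ ?_
    · intro s hsR c hsc
      rw [← mul_assoc, hδe]
      split_ifs with hc
      · subst hc
        rw [hs s hsR hsc, hγR s hsR c hsc]; simp
      · exact hγR s hsR c hsc
    · change m (γ * δ) < m γ
      refine Finset.sum_lt_sum (fun c _ => ?_) ⟨i, hi, ?_⟩
      · rw [← mul_assoc, hδe]
        split_ifs with hc
        · subst hc; exact hlt'.le
        · exact le_rfl
      · rw [← mul_assoc, hδe, if_pos rfl]
        exact hlt'
  have hodd := levelTwo.odd_ex hβ r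
  have hrr : ex Γ r (β (gen Γ r)) ≠ 0 := by
    intro h; rw [h] at hodd; exact absurd hodd (by decide)
  have hrT : r ∈ T := by simp [T]
  have hlt : ∀ c, Γ.Adj r c → ex Γ r (β (gen Γ c)) ≠ 0 →
      (ex Γ r (β (gen Γ c))).natAbs < (ex Γ r (β (gen Γ r))).natAbs := by
    intro c hc h0
    have hdom := dominates_of_ex_ne_zero hβ h0
    refine lt_of_le_of_ne (hop c r (by simp [T, hc]) hc.ne' hdom ?_ hrr) ?_
    -- A row s ∈ R with a nonzero entry at r would dominate r, hence be adjacent to r, against its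
    -- cleanness; so the operation is admissible.
    · intro s hsR _
      by_contra hne
      have hsr : s ≠ r := fun h => hrR (h ▸ hsR)
      have := hdom.adj_of_dominates hc.symm (dominates_of_ex_ne_zero hβ hne) hsr
      exact hne (hγR s hsR r this.symm)
    -- Equality is excluded by parity: off-diagonal entries are even, the diagonal one is odd.
    · have heven := levelTwo.even_ex hβ hc.ne'
      intro heq
      rw [Int.natAbs_eq_natAbs_iff] at heq
      rcases heq with h | h
      · rw [h] at heven; exact (Int.not_even_iff_odd.2 hodd) heven
      · rw [h] at heven; exact (Int.not_even_iff_odd.2 hodd) (by simpa using heven)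
  -- Here column c could be used to reduce column r, so minimality gives the inequality opposite to
  -- `hlt`.
  have hrow : ∀ c, Γ.Adj r c → Dominates Γ c r → c ∉ R → ex Γ r (β (gen Γ c)) = 0 := by
    intro c hc hcr hcR
    by_contra h0
    have hdom := dominates_of_ex_ne_zero hβ h0
    refine (hlt c hc h0).not_ge (hop r c hrT hc.ne hcr ?_ h0)
    intro s hsR hsr
    by_contra hne
    have hsc : s ≠ c := fun h => hcR (h ▸ hsR)
    have := hcr.adj_of_dominates hc (dominates_of_ex_ne_zero hβ hne) hsc
    exact hne (hγR s hsR c this.symm)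
  intro s hs
  rcases hs with rfl | hs
  · intro c hc
    by_contra h0
    have hdom := dominates_of_ex_ne_zero hβ h0
    have h1 := natAbs_ex_diag_eq_one hβ hγR hc.symm hdom hrow
    have h2 := hlt c hc h0
    rw [h1] at h2
    exact h0 (Int.natAbs_eq_zero.1 (by omega))
  · exact hγR s hs

theorem exists_clean [Finite V] [DecidableEq V] {α : MulAut (RAAG Γ)} (hα : α ∈ levelTwo Γ) :
    ∃ γ ∈ palGroup Γ, ∀ s, CleanRow Γ (α * γ) s := by
  have key : ∀ R : Set V, R.Finite → ∃ γ ∈ palGroup Γ, ∀ s ∈ R, CleanRow Γ (α * γ) s := by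
    intro R hR
    induction R, hR using Set.Finite.induction_on with
    | empty => exact ⟨1, one_mem _, by simp⟩
    | @insert r R _ _ ih =>
      obtain ⟨γ, hγ, h⟩ := ih
      obtain ⟨δ, hδ, h'⟩ := exists_cleanRow_insert r
        (mul_mem hα (palGroup_le_levelTwo hγ)) h
      exact ⟨γ * δ, mul_mem hγ hδ, by simpa [mul_assoc] using h'⟩
  obtain ⟨γ, hγ, h⟩ := key Set.univ Set.finite_univ
  exact ⟨γ, hγ, fun s => h s (Set.mem_univ s)⟩

/-- In row k of the matrix times column i of its inverse, domination makes every other contributing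
index adjacent to k, where row k vanishes; only the odd diagonal term survives. -/
theorem CleanRow.inv [Finite V] {α : MulAut (RAAG Γ)} (hα : α ∈ levelTwo Γ)
    (h : ∀ s, CleanRow Γ α s) (k : V) : CleanRow Γ α⁻¹ k := by
  classical
  have : Fintype V := Fintype.ofFinite V
  intro i hki
  by_contra hne
  have hdom : Dominates Γ k i := dominates_of_ex_ne_zero (inv_mem hα) hne
  have h1 : ∑ c, ex Γ k (α (gen Γ c)) * ex Γ c (α⁻¹ (gen Γ i)) = ex Γ k (gen Γ i) := by
    rw [← ex_map, MulAut.apply_inv_self]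
  rw [ex_gen_of_ne hki.ne', Finset.sum_eq_single k] at h1
  · rcases mul_eq_zero.1 h1 with h2 | h2
    · have := levelTwo.odd_ex hα k
      rw [h2] at this
      exact absurd this (by decide)
    · exact hne h2
  · intro c _ hck
    by_cases hx : ex Γ c (α⁻¹ (gen Γ i)) = 0
    · rw [hx, mul_zero]
    · have hc : Dominates Γ c i := dominates_of_ex_ne_zero (inv_mem hα) hx
      have : Γ.Adj k c := ((hc hki.symm).resolve_left (Ne.symm hck)).symm
      rw [h k c this, zero_mul]
  · simp

end Clean

end RAAG

/-! ### HNN extensions with centralizing stable letter, and stable exponents. -/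

/-- The HNN extension of `G` whose stable letter centralizes `L`. -/
abbrev CentralHNN {G : Type*} [Group G] (L : Subgroup G) : Type _ :=
  HNNExtension G L L (MulEquiv.refl L)

namespace CentralHNN

open HNNExtension

variable {G : Type*} [Group G] (L : Subgroup G)

theorem toSubgroup_eq (u : ℤˣ) : toSubgroup L L u = L := by
  unfold toSubgroup; split_ifs <;> rfl

/-- The product of a word with head `h`. -/
def wordProd (h : G) (l : List (ℤˣ × G)) : CentralHNN L :=
  of h * (l.map fun x => (t ^ (x.1 : ℤ) * of x.2 : CentralHNN L)).prod

/-- A word without a pinch. -/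
def Red (l : List (ℤˣ × G)) : Prop :=
  l.IsChain fun a b => a.2 ∈ L → a.1 = b.1

/-- `s` is the list of exponents of the stable letter in a reduced word for `z`. -/
def HasSig (z : CentralHNN L) (s : List ℤˣ) : Prop :=
  ∃ h l, Red L l ∧ z = wordProd L h l ∧ l.map Prod.fst = s

variable {L}

theorem wordProd_cons (h : G) (a : ℤˣ × G) (l : List (ℤˣ × G)) :
    wordProd L h (a :: l) = of h * (t ^ (a.1 : ℤ) * wordProd L a.2 l) := by
  simp [wordProd, mul_assoc]

theorem wordProd_append (h : G) (l l' : List (ℤˣ × G)) :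
    wordProd L h (l ++ l') = wordProd L h l * wordProd L 1 l' := by
  simp [wordProd, mul_assoc]

theorem of_mul_wordProd (g h : G) (l : List (ℤˣ × G)) :
    of g * wordProd L h l = wordProd L (g * h) l := by
  simp [wordProd, mul_assoc]

/-- Britton's lemma: equal reduced words have the same stable exponents, and their heads lie in one
coset of L. -/
theorem wordProd_eq_imp {h h' : G} {l l' : List (ℤˣ × G)} (hl : Red L l) (hl' : Red L l')
    (he : wordProd L h l = wordProd L h' l') :
    l.map Prod.fst = l'.map Prod.fst ∧ (l ≠ [] → h⁻¹ * h' ∈ L) := by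
  have key := ReducedWord.map_fst_eq_and_of_prod_eq (MulEquiv.refl L)
    (w₁ := ⟨h, l, by simp only [toSubgroup_eq]; exact hl⟩)
    (w₂ := ⟨h', l', by simp only [toSubgroup_eq]; exact hl'⟩) he
  refine ⟨key.1, fun hne => ?_⟩
  obtain ⟨a, l, rfl⟩ := List.exists_cons_of_ne_nil hne
  have := key.2 a.1 (by simp)
  rwa [toSubgroup_eq] at this

theorem HasSig.unique {z : CentralHNN L} {s s' : List ℤˣ} (h : HasSig L z s)
    (h' : HasSig L z s') : s = s' := by
  obtain ⟨a, l, hl, rfl, rfl⟩ := h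
  obtain ⟨a', l', hl', he, rfl⟩ := h'
  exact (wordProd_eq_imp hl hl' he).1

theorem exists_hasSig (z : CentralHNN L) : ∃ s, HasSig L z s := by
  obtain ⟨d⟩ := NormalWord.TransversalPair.nonempty G L L
  obtain ⟨w, rfl⟩ := (NormalWord.equiv (MulEquiv.refl L) d).symm.surjective z
  refine ⟨_, w.head, w.toList, ?_, rfl, rfl⟩
  have := w.chain
  simpa only [toSubgroup_eq, Red] using this

/-- The exponents of the stable letter in a reduced word. -/
noncomputable def sig (z : CentralHNN L) : List ℤˣ := (exists_hasSig z).choose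

theorem hasSig_sig (z : CentralHNN L) : HasSig L z (sig z) := (exists_hasSig z).choose_spec

theorem HasSig.sig_eq {z : CentralHNN L} {s : List ℤˣ} (h : HasSig L z s) : sig z = s :=
  (hasSig_sig z).unique h

theorem sig_of_mul (g : G) (z : CentralHNN L) : sig (of g * z) = sig z := by
  obtain ⟨h, l, hl, hz, hs⟩ := hasSig_sig z
  exact HasSig.sig_eq ⟨g * h, l, hl, by rw [hz, of_mul_wordProd], hs⟩

theorem red_append {l l' : List (ℤˣ × G)} : Red L (l ++ l') ↔
    Red L l ∧ Red L l' ∧ ∀ a ∈ l.getLast?, ∀ b ∈ l'.head?, a.2 ∈ L → a.1 = b.1 :=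
  List.isChain_append

theorem exists_word_mul_of {h : G} {l : List (ℤˣ × G)} (hl : Red L l) (g : G) :
    ∃ h' l', Red L l' ∧ wordProd L h l * of g = wordProd L h' l' ∧
      l'.map Prod.fst = l.map Prod.fst ∧ (l ≠ [] → h' = h) := by
  rcases l.eq_nil_or_concat with rfl | ⟨l₀, a, rfl⟩
  · exact ⟨h * g, [], List.isChain_nil, by simp [wordProd], rfl, by simp⟩
  · refine ⟨h, l₀ ++ [(a.1, a.2 * g)], ?_, ?_, by simp, by simp⟩
    · rw [List.concat_eq_append, red_append] at hl
      rw [red_append]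
      refine ⟨hl.1, List.isChain_singleton _, fun x hx b hb => ?_⟩
      have := hl.2.2 x hx a rfl
      simp only [List.head?_cons, Option.mem_def, Option.some.injEq] at hb
      rw [← hb]; exact this
    · simp [wordProd, mul_assoc]

theorem sig_mul_of (z : CentralHNN L) (g : G) : sig (z * of g) = sig z := by
  obtain ⟨h, l, hl, hz, hs⟩ := hasSig_sig z
  obtain ⟨h', l', hl', he, hs', -⟩ := exists_word_mul_of (h := h) hl g
  exact HasSig.sig_eq ⟨h', l', hl', by rw [hz, he], by rw [hs', hs]⟩

/-- Equal exponents at the junction cannot form a pinch, whatever base element separates them. -/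
theorem sig_mul {z w : CentralHNN L}
    (h : ∀ a ∈ (sig z).getLast?, ∀ b ∈ (sig w).head?, a = b) : sig (z * w) = sig z ++ sig w := by
  obtain ⟨a, l, hl, hz, hs⟩ := hasSig_sig z
  obtain ⟨b, l', hl', hw, hs'⟩ := hasSig_sig w
  obtain ⟨c, m, hm, he, hms, -⟩ := exists_word_mul_of (h := a) hl b
  rw [hs] at hms
  refine HasSig.sig_eq ⟨c, m ++ l', ?_, ?_, ?_⟩
  · rw [red_append]
    refine ⟨hm, hl', fun x hx y hy _ => h _ ?_ _ ?_⟩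
    · rw [← hms, List.getLast?_map]
      exact Option.mem_map_of_mem _ hx
    · rw [← hs', List.head?_map]
      exact Option.mem_map_of_mem _ hy
  · rw [wordProd_append, ← he, hz, hw, mul_assoc, of_mul_wordProd, mul_one]
  · rw [List.map_append, hms, hs']

/-- The clause on the last letter serves the induction: it decides whether the appended stable
letter makes a pinch. -/
theorem exists_word_inv (h : G) (l : List (ℤˣ × G)) (hl : Red L l) :
    ∃ h' l', Red L l' ∧ (wordProd L h l)⁻¹ = wordProd L h' l' ∧
      l'.map Prod.fst = ((l.map Prod.fst).reverse.map fun e => -e) ∧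
      ∀ a ∈ l'.getLast?, a.2 = h⁻¹ := by
  induction l generalizing h with
  | nil => exact ⟨h⁻¹, [], List.isChain_nil, by simp [wordProd], rfl, by simp⟩
  | cons a l ih =>
    have hl2 := List.isChain_cons.1 hl
    obtain ⟨h', l', hl', he, hs, hlast⟩ := ih a.2 hl2.2
    refine ⟨h', l' ++ [(-a.1, h⁻¹)], ?_, ?_, ?_, by simp⟩
    · rw [red_append]
      refine ⟨hl', List.isChain_singleton _, fun x hx b hb hxL => ?_⟩
      simp only [List.head?_cons, Option.mem_def, Option.some.injEq] at hb
      rw [← hb]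
      rw [hlast x hx, inv_mem_iff] at hxL
      have h1 : x.1 ∈ (l'.map Prod.fst).getLast? := by
        rw [List.getLast?_map]; exact Option.mem_map_of_mem _ hx
      rw [hs, List.getLast?_map, List.getLast?_reverse, List.head?_map] at h1
      simp only [Option.map_map, Option.mem_def, Option.map_eq_some_iff] at h1
      obtain ⟨b', hb', hx'⟩ := h1
      rw [← hx', hl2.1 b' hb' hxL]; rfl
    · rw [wordProd_cons, wordProd_append, mul_inv_rev, mul_inv_rev, he]
      simp [wordProd, mul_assoc]
    · simp [hs]

theorem sig_inv (z : CentralHNN L) : sig z⁻¹ = (sig z).reverse.map fun e => -e := by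
  obtain ⟨h, l, hl, hz, hs⟩ := hasSig_sig z
  obtain ⟨h', l', hl', he, hs', -⟩ := exists_word_inv h l hl
  exact HasSig.sig_eq ⟨h', l', hl', by rw [hz, he], by rw [hs', hs]⟩

/-- The endomorphism extending `f` and inverting the stable letter. -/
def flip (f : G →* G) (hf : ∀ x ∈ L, f x ∈ L) : CentralHNN L →* CentralHNN L :=
  HNNExtension.lift (of.comp f) t⁻¹ fun a =>
    inv_t_mul_of (φ := MulEquiv.refl L) (⟨f a, hf a a.2⟩ : L)

theorem flip_of (f : G →* G) (hf : ∀ x ∈ L, f x ∈ L) (g : G) :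
    flip f hf (of g) = of (f g) := HNNExtension.lift_of _ _ _ g

theorem flip_t (f : G →* G) (hf : ∀ x ∈ L, f x ∈ L) : flip f hf t = t⁻¹ :=
  HNNExtension.lift_t _ _ _

theorem sig_flip (f : G →* G) (hf : ∀ x, f x ∈ L ↔ x ∈ L) (z : CentralHNN L) :
    sig (flip f (fun x hx => (hf x).2 hx) z) = (sig z).map fun e => -e := by
  obtain ⟨h, l, hl, hz, hs⟩ := hasSig_sig z
  refine HasSig.sig_eq ⟨f h, l.map fun a => (-a.1, f a.2), ?_, ?_, ?_⟩
  · refine (List.isChain_map _).2 (hl.imp fun a b hab hL => ?_)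
    rw [hab ((hf _).1 hL)]
  · rw [hz]
    simp [wordProd, flip_of, flip_t, map_list_prod, Function.comp_def]
  · rw [← hs]; simp [Function.comp_def]

/-- The flip negates the exponents, inversion negates and reverses them. -/
theorem sig_reverse_of_flip_eq_inv {f : G →* G} (hf : ∀ x, f x ∈ L ↔ x ∈ L) {z : CentralHNN L}
    (hz : flip f (fun x hx => (hf x).2 hx) z = z⁻¹) : (sig z).reverse = sig z := by
  have h := sig_flip f hf z
  rw [hz, sig_inv] at h
  exact (List.map_injective_iff.2 neg_injective) h

theorem sig_mul_of_reverse {z w : CentralHNN L} (hz : (sig z).reverse = sig z)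
    (h : ∀ a ∈ (sig z).head?, ∀ b ∈ (sig w).head?, a = b) : sig (z * w) = sig z ++ sig w :=
  sig_mul (by rwa [← List.head?_reverse, hz])

/-- A palindromic list begins and ends with the same exponent, so consecutive copies never cancel.
The clause on the head carries the induction. -/
theorem length_sig_pow {z : CentralHNN L} (hz : (sig z).reverse = sig z) (n : ℕ) :
    (sig (z ^ n)).length = n * (sig z).length ∧
      ∀ b ∈ (sig (z ^ n)).head?, b ∈ (sig z).head? := by
  induction n with
  | zero =>
    have : sig (1 : CentralHNN L) = [] :=
      HasSig.sig_eq ⟨1, [], List.isChain_nil, by simp [wordProd], rfl⟩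
    simp [this]
  | succ n ih =>
    have h1 : sig (z ^ (n + 1)) = sig z ++ sig (z ^ n) := by
      rw [pow_succ']
      exact sig_mul_of_reverse hz fun a ha b hb => Option.mem_unique ha (ih.2 b hb)
    rw [h1, List.length_append, ih.1]
    refine ⟨by ring, fun b hb => ?_⟩
    cases hs : sig z with
    | nil => rw [hs, List.nil_append] at hb; simpa [hs] using ih.2 b hb
    | cons a s => simpa [hs] using hb

theorem length_sig_zpow_mul (e : ℤˣ) (z : CentralHNN L) :
    (sig (t ^ (e : ℤ) * z)).length ≤ (sig z).length + 1 := by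
  obtain ⟨h, l, hl, hz, hs⟩ := hasSig_sig z
  rw [← hs, hz, List.length_map]
  by_cases hred : Red L ((e, h) :: l)
  · have : HasSig L (t ^ (e : ℤ) * wordProd L h l) (((e, h) :: l).map Prod.fst) :=
      ⟨1, _, hred, by simp [wordProd_cons], rfl⟩
    rw [this.sig_eq]; simp
  · cases l with
    | nil => exact absurd (List.isChain_singleton _) hred
    | cons a l =>
      have hl2 := List.isChain_cons_cons (R := fun a b : ℤˣ × G => a.2 ∈ L → a.1 = b.1)
        (a := (e, h)) (b := a) (l := l)
      have hcan : h ∈ L ∧ e ≠ a.1 := by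
        by_contra hcon
        refine hred (hl2.2 ⟨fun hh => ?_, hl⟩)
        by_contra hne
        exact hcon ⟨hh, hne⟩
      have hea : e = -a.1 := by
        rcases Int.units_eq_one_or e with h1 | h1 <;> rcases Int.units_eq_one_or a.1 with h2 | h2 <;>
          simp_all
      have hcomm : (t ^ (e : ℤ) * of h : CentralHNN L) = of h * t ^ (e : ℤ) := by
        have : Commute (t : CentralHNN L) (of h) := t_mul_of (φ := MulEquiv.refl L) ⟨h, hcan.1⟩
        exact (this.zpow_left _).eq
      have : HasSig L (t ^ (e : ℤ) * wordProd L h (a :: l)) (l.map Prod.fst) := by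
        refine ⟨h * a.2, l, (List.isChain_cons.1 hl).2, ?_, rfl⟩
        rw [wordProd_cons, ← mul_assoc, hcomm, hea, mul_assoc, ← mul_assoc (t ^ _), ← zpow_add]
        simp [of_mul_wordProd]
      rw [this.sig_eq]; simp; omega

theorem length_sig_mul_le (z w : CentralHNN L) :
    (sig (z * w)).length ≤ (sig z).length + (sig w).length := by
  obtain ⟨h, l, -, hz, hs⟩ := hasSig_sig z
  rw [← hs, hz, List.length_map]
  clear hz hs
  induction l generalizing h with
  | nil => simp [wordProd, sig_of_mul]
  | cons a l ih =>
    rw [wordProd_cons, mul_assoc, sig_of_mul, mul_assoc]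
    refine (length_sig_zpow_mul _ _).trans ?_
    have := ih a.2
    simp only [List.length_cons]; omega

/-- An element with palindromic exponent list conjugate into the base lies in the base. -/
theorem sig_eq_nil_of_conj {z h : CentralHNN L} (hz : (sig z).reverse = sig z) {g : G}
    (he : z = h * of g * h⁻¹) : sig z = [] := by
  by_contra hne
  have hpos : 0 < (sig z).length := List.length_pos_iff.2 hne
  -- The conjugate of a base element has length at most 2|h|, while zⁿ has length at least n.
  let n := 2 * (sig h).length + 1
  have h1 := (length_sig_pow hz n).1
  have h2 : z ^ n = h * of (g ^ n) * h⁻¹ := by rw [he, conj_pow, map_pow]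
  have h3 := length_sig_mul_le (h * of (g ^ n)) h⁻¹
  rw [← h2, h1, sig_mul_of, sig_inv, List.length_map, List.length_reverse] at h3
  have : n * 1 ≤ n * (sig z).length := Nat.mul_le_mul_left _ hpos
  omega

/-- After replacing y by y⁻¹ if needed, neither zy nor yz cancels; the two concatenations agree, and
equal lengths identify the halves. -/
theorem sig_eq_or_of_commute {z y : CentralHNN L} (hz : (sig z).reverse = sig z)
    (hy : (sig y).reverse = sig y) (hzy : Commute z y) (hl : (sig z).length = (sig y).length) :
    sig z = sig y ∨ sig z = sig y⁻¹ := by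
  have aux : ∀ {y : CentralHNN L}, (sig y).reverse = sig y → Commute z y →
      (sig z).length = (sig y).length →
      (∀ a ∈ (sig z).head?, ∀ b ∈ (sig y).head?, a = b) → sig z = sig y := by
    intro y hy hzy hl h
    have h1 := sig_mul_of_reverse hz h
    have h2 := sig_mul_of_reverse hy (w := z) fun a ha b hb => (h b hb a ha).symm
    rw [hzy.eq, h2] at h1
    exact ((List.append_inj h1 hl.symm).1).symm
  have hyi : sig y⁻¹ = (sig y).map fun e => -e := by rw [sig_inv, hy]
  by_cases h : ∀ a ∈ (sig z).head?, ∀ b ∈ (sig y).head?, a = b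
  · exact Or.inl (aux hy hzy hl h)
  · right
    push Not at h
    obtain ⟨a, ha, b, hb, hab⟩ := h
    refine aux ?_ hzy.inv_right ?_ ?_
    · rw [hyi, ← List.map_reverse, hy]
    · rw [hyi, List.length_map, hl]
    · intro a' ha' b' hb'
      rw [hyi, List.head?_map, Option.mem_def, Option.map_eq_some_iff] at hb'
      obtain ⟨c, hc, rfl⟩ := hb'
      rw [Option.mem_unique ha' ha, Option.mem_unique hc hb]
      rcases Int.units_eq_one_or a with h1 | h1 <;> rcases Int.units_eq_one_or b with h2 | h2 <;>
        simp_all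

/-- The exponent sum of the stable letter. -/
def expHom : CentralHNN L →* Multiplicative ℤ :=
  HNNExtension.lift 1 (Multiplicative.ofAdd 1) fun _ => by simp

theorem expHom_eq (z : CentralHNN L) :
    expHom z = ((sig z).map fun e : ℤˣ => Multiplicative.ofAdd (e : ℤ)).prod := by
  obtain ⟨h, l, -, hz, hs⟩ := hasSig_sig z
  rw [← hs, hz]
  simp [wordProd, expHom, map_list_prod, Function.comp_def, ← ofAdd_zsmul]

theorem exists_of_eq {z : CentralHNN L} (h : sig z = []) : ∃ g, z = of g := by
  obtain ⟨g, l, -, hz, hs⟩ := hasSig_sig z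
  rw [h, List.map_eq_nil_iff] at hs
  exact ⟨g, by rw [hz, hs]; simp [wordProd]⟩

/-- An element of the base commuting with an element outside the base is conjugate into `L`. -/
theorem exists_conj_of_commute {g : G} {y : CentralHNN L} (hy : sig y ≠ [])
    (h : Commute (of g) y) : ∃ a, a⁻¹ * g * a ∈ L := by
  obtain ⟨a, l, hl, hz, hs⟩ := hasSig_sig y
  have hne : l ≠ [] := by rintro rfl; exact hy hs.symm
  obtain ⟨h', l', hl', he, -, hhead⟩ := exists_word_mul_of (h := a) hl g
  -- Left multiplication by g changes the head, while right multiplication leaves it alone;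
  -- Britton's lemma compares the two heads.
  have h1 : wordProd L (g * a) l = wordProd L h' l' := by
    rw [← of_mul_wordProd, ← he, ← hz, h.eq]
  have := (wordProd_eq_imp hl hl' h1).2 hne
  rw [hhead hne] at this
  refine ⟨a, ?_⟩
  rw [← inv_mem_iff]
  simpa [mul_assoc] using this

end CentralHNN

namespace RAAG

/-! ### Splitting over the link of a vertex. -/

section Splitting

open CentralHNN

variable {V : Type*} (Γ : SimpleGraph V)

open Classical in
/-- The homomorphism to the HNN extension over the link of `k`, sending `k` to the stable letter. -/
noncomputable def toHNN (k : V) : RAAG Γ →* CentralHNN (parab Γ (Γ.neighborSet k)) :=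
  lift (fun v => if v = k then HNNExtension.t else HNNExtension.of (gen Γ v)) (by
    have key : ∀ v, Γ.Adj k v → Commute
        (HNNExtension.t : CentralHNN (parab Γ (Γ.neighborSet k)))
        (HNNExtension.of (gen Γ v)) := fun v hv =>
      HNNExtension.t_mul_of (φ := MulEquiv.refl _) ⟨gen Γ v, gen_mem_parab hv⟩
    intro u v huv
    split_ifs with h1 h2 h2
    · exact Commute.refl _
    · subst h1; exact key v huv
    · subst h2; exact (key u huv.symm).symm
    · exact (commute_gen Γ huv).map _)

variable {Γ}

theorem toHNN_gen_self (k : V) : toHNN Γ k (gen Γ k) = HNNExtension.t := by simp [toHNN]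

theorem toHNN_gen_of_ne {k v : V} (h : v ≠ k) :
    toHNN Γ k (gen Γ v) = HNNExtension.of (gen Γ v) := by simp [toHNN, h]

/-- Evaluating the stable letter at `x`. -/
noncomputable def hnnEval (k : V) (x : RAAG Γ)
    (hx : ∀ a ∈ parab Γ (Γ.neighborSet k), Commute x a) :
    CentralHNN (parab Γ (Γ.neighborSet k)) →* RAAG Γ :=
  HNNExtension.lift (MonoidHom.id _) x fun a => hx a a.2

theorem hnnEval_of (k : V) (x : RAAG Γ) (hx) (g : RAAG Γ) :
    hnnEval (Γ := Γ) k x hx (HNNExtension.of g) = g := HNNExtension.lift_of _ _ _ g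

theorem hnnEval_t (k : V) (x : RAAG Γ) (hx) :
    hnnEval (Γ := Γ) k x hx HNNExtension.t = x := HNNExtension.lift_t _ _ _

theorem commute_of_mem_parab_neighborSet {k : V} {a : RAAG Γ}
    (ha : a ∈ parab Γ (Γ.neighborSet k)) : Commute (gen Γ k) a := by
  have := map_mem_of_mem_parab (f := MonoidHom.id (RAAG Γ))
    (H := Subgroup.centralizer {gen Γ k}) (fun v hv => by
      rw [Subgroup.mem_centralizer_singleton_iff]
      exact (commute_gen Γ hv).eq.symm) ha
  rw [Subgroup.mem_centralizer_singleton_iff] at this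
  exact Eq.symm this

/-- Evaluating the stable letter at `gen Γ k` recovers x, and evaluating it at 1 retracts x away
from k; both return g on a base element. The base may thus be the whole group rather than the
subgroup on the other vertices. -/
theorem mem_parab_compl_of_toHNN {k : V} {x g : RAAG Γ}
    (h : toHNN Γ k x = HNNExtension.of g) : x = g ∧ x ∈ parab Γ {k}ᶜ := by
  have h1 : hnnEval k (gen Γ k) (fun _ => commute_of_mem_parab_neighborSet) (toHNN Γ k x) = x := by
    refine DFunLike.congr_fun (f := (hnnEval k (gen Γ k) fun _ => commute_of_mem_parab_neighborSet).comp (toHNN Γ k))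
      (g := MonoidHom.id _) (hom_ext fun v => ?_) x
    by_cases hv : v = k
    · subst hv; simp [toHNN_gen_self, hnnEval_t]
    · simp [toHNN_gen_of_ne hv, hnnEval_of]
  have h2 : hnnEval k 1 (fun a _ => Commute.one_left a) (toHNN Γ k x) = ret Γ {k}ᶜ x := by
    refine DFunLike.congr_fun (f := (hnnEval k 1 fun a _ => Commute.one_left a).comp (toHNN Γ k)) (hom_ext fun v => ?_) x
    by_cases hv : v = k
    · subst hv; simp [toHNN_gen_self, hnnEval_t, ret_gen_of_notMem]
    · simp [toHNN_gen_of_ne hv, hnnEval_of, ret_gen, hv]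
  rw [h, hnnEval_of] at h1 h2
  exact ⟨h1.symm, by rw [mem_parab, ← h2, h1]⟩

theorem toHNN_of_mem_parab {k : V} {x : RAAG Γ} (h : x ∈ parab Γ {k}ᶜ) :
    toHNN Γ k x = HNNExtension.of x :=
  eq_of_mem_parab (g := HNNExtension.of) (fun _ hv => toHNN_gen_of_ne hv) h

theorem expHom_toHNN (k : V) (x : RAAG Γ) : (expHom (toHNN Γ k x)).toAdd = ex Γ k x := by
  have : expHom.comp (toHNN Γ k) = exHom Γ k := hom_ext fun v => by
    by_cases hv : v = k
    · subst hv
      rw [MonoidHom.comp_apply, toHNN_gen_self]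
      simp only [exHom, lift_gen, if_true]
      exact HNNExtension.lift_t _ _ _
    · rw [MonoidHom.comp_apply, toHNN_gen_of_ne hv]
      simp only [exHom, lift_gen, if_neg hv]
      exact HNNExtension.lift_of _ _ _ _
  rw [ex, ← this]; rfl

theorem invAll_mem_parab_iff {S : Set V} {x : RAAG Γ} :
    invAll Γ x ∈ parab Γ S ↔ x ∈ parab Γ S :=
  ⟨fun h => by simpa using invAll_mem_parab h, invAll_mem_parab⟩

theorem sig_toHNN_reverse {k : V} {x : RAAG Γ} (hx : invAll Γ x = x⁻¹) :
    (sig (toHNN Γ k x)).reverse = sig (toHNN Γ k x) := by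
  refine sig_reverse_of_flip_eq_inv (f := (invAll Γ).toMonoidHom)
    (fun x => invAll_mem_parab_iff) ?_
  rw [← map_inv, ← hx]
  refine DFunLike.congr_fun
    (f := (flip (invAll Γ).toMonoidHom fun x hx => invAll_mem_parab hx).comp (toHNN Γ k))
    (g := (toHNN Γ k).comp (invAll Γ).toMonoidHom) (hom_ext fun v => ?_) x
  by_cases hv : v = k
  · subst hv; simp [toHNN_gen_self, flip_t]
  · simp [toHNN_gen_of_ne hv, flip_of]

/-- For each u outside S, x is conjugate into the base of the splitting at u; being inverted by ι,
it lies in the base itself. -/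
theorem mem_parab_of_conj [Finite V] {S : Set V} {x a l : RAAG Γ} (hx : invAll Γ x = x⁻¹)
    (hl : l ∈ parab Γ S) (h : x = a * l * a⁻¹) : x ∈ parab Γ S := by
  refine mem_parab_of_forall fun u hu => ?_
  have hl' : l ∈ parab Γ {u}ᶜ := parab_mono (fun v hv => by rintro rfl; exact hu hv) hl
  obtain ⟨g, hg⟩ := exists_of_eq (sig_eq_nil_of_conj (sig_toHNN_reverse (k := u) hx)
    (h := toHNN Γ u a) (g := l) (by rw [h, ← toHNN_of_mem_parab hl', map_mul, map_mul, map_inv]))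
  exact (mem_parab_compl_of_toHNN hg).2

theorem mem_parab_of_commute [Finite V] {k : V} {x y : RAAG Γ} (hx : invAll Γ x = x⁻¹)
    (hy : invAll Γ y = y⁻¹) (hxy : Commute x y) (hxk : ex Γ k x = 0) (hyk : ex Γ k y ≠ 0) :
    x ∈ parab Γ (Γ.neighborSet k) := by
  have hexp : ∀ w w' : RAAG Γ, sig (toHNN Γ k w) = sig (toHNN Γ k w') → ex Γ k w = ex Γ k w' := by
    intro w w' h
    rw [← expHom_toHNN, ← expHom_toHNN, expHom_eq, expHom_eq, h]
  have hysig : sig (toHNN Γ k y) ≠ [] := by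
    intro h
    apply hyk
    rw [← expHom_toHNN, expHom_eq, h]; simp
  have hpow : ∀ {w : RAAG Γ} (n : ℕ), invAll Γ w = w⁻¹ → invAll Γ (w ^ n) = (w ^ n)⁻¹ := by
    intro w n hw
    rw [map_pow, hw, inv_pow]
  set m := (sig (toHNN Γ k x)).length with hm
  set l := (sig (toHNN Γ k y)).length with hl
  have hxsig : sig (toHNN Γ k x) = [] := by
    -- The powers are chosen to equalize the lengths. Equal lists have equal sums, so yᵐ has
    -- exponent 0 at k, whence m = 0.
    have h1 : (sig (toHNN Γ k (x ^ l))).length = (sig (toHNN Γ k (y ^ m))).length := by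
      rw [map_pow, map_pow, (length_sig_pow (sig_toHNN_reverse hx) l).1,
        (length_sig_pow (sig_toHNN_reverse hy) m).1, ← hl, ← hm, mul_comm]
    have h2 := sig_eq_or_of_commute (sig_toHNN_reverse (hpow l hx)) (sig_toHNN_reverse (hpow m hy))
      ((hxy.pow_pow l m).map (toHNN Γ k)) h1
    have h3 : ex Γ k (x ^ l) = 0 := by rw [ex_pow, hxk, mul_zero]
    have h4 : ex Γ k (y ^ m) = 0 := by
      rcases h2 with h2 | h2
      · rw [← hexp _ _ h2, h3]
      · rw [← map_inv] at h2
        have := hexp _ _ h2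
        rw [h3, ex_inv] at this
        linarith
    rw [ex_pow] at h4
    have h5 : (m : ℤ) = 0 := (mul_eq_zero.1 h4).resolve_right hyk
    exact List.length_eq_zero_iff.1 (by exact_mod_cast h5)
  obtain ⟨g, hg⟩ := exists_of_eq hxsig
  obtain rfl := (mem_parab_compl_of_toHNN hg).1
  obtain ⟨a, ha⟩ := exists_conj_of_commute hysig (g := x) (by
    rw [← hg]; exact hxy.map _)
  exact mem_parab_of_conj hx ha (a := a) (by group)

end Splitting

/-! ### Automorphisms preserving the link filtration. -/

section LinkPreserving

variable {V : Type*} (Γ : SimpleGraph V)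

/-- The vertices whose link contains the link of `i`. -/
def linkUp (i : V) : Set V := {u | Γ.neighborSet i ⊆ Γ.neighborSet u}

variable {Γ}

theorem linkUp_subset {i j : V} (h : j ∈ linkUp Γ i) : linkUp Γ j ⊆ linkUp Γ i :=
  fun _ hu => Set.Subset.trans h hu

theorem self_mem_linkUp (i : V) : i ∈ linkUp Γ i :=
  Set.Subset.refl (Γ.neighborSet i)

theorem dominates_of_mem_linkUp {i j : V} (h : j ∈ linkUp Γ i) : Dominates Γ j i :=
  fun _ hw => Or.inr (h hw)

theorem map_gen_mem_parab_linkUp [Finite V] {α : MulAut (RAAG Γ)} (hα : α ∈ levelTwo Γ)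
    (hc : ∀ s, CleanRow Γ α s) (i : V) : α (gen Γ i) ∈ parab Γ (linkUp Γ i) := by
  refine mem_parab_of_forall fun u hu => ?_
  -- A neighbour k of i not adjacent to u: α(i) commutes with α(k) and so lies in the subgroup on
  -- lk(k), which misses u.
  obtain ⟨k, hk, hku⟩ := Set.not_subset.1 hu
  refine parab_mono ?_ (mem_parab_of_commute (k := k) (levelTwo.invAll_eq hα i)
    (levelTwo.invAll_eq hα k) ((commute_gen Γ hk).map α) (hc k i (Γ.adj_symm hk)) ?_)
  · rintro v hv rfl
    exact hku (Γ.adj_symm hv)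
  · intro h
    have := levelTwo.odd_ex hα k
    rw [h] at this
    exact absurd this (by decide)

variable (Γ) in
/-- The automorphisms preserving all subgroups generated by the vertices with link containing
a given link. -/
def linkPreserving : Subgroup (MulAut (RAAG Γ)) where
  carrier := {α | ∀ i, ∀ x ∈ parab Γ (linkUp Γ i),
    α x ∈ parab Γ (linkUp Γ i) ∧ α⁻¹ x ∈ parab Γ (linkUp Γ i)}
  one_mem' := fun _ _ hx => ⟨hx, hx⟩
  mul_mem' := fun {α β} hα hβ i x hx =>
    ⟨(hα i _ (hβ i x hx).1).1, by
      rw [mul_inv_rev]; exact (hβ i _ (hα i x hx).2).2⟩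
  inv_mem' := fun {α} hα i x hx => ⟨(hα i x hx).2, by rw [inv_inv]; exact (hα i x hx).1⟩

theorem mem_linkPreserving {α : MulAut (RAAG Γ)}
    (h : ∀ i, α (gen Γ i) ∈ parab Γ (linkUp Γ i))
    (h' : ∀ i, α⁻¹ (gen Γ i) ∈ parab Γ (linkUp Γ i)) : α ∈ linkPreserving Γ :=
  fun _ _ hx =>
    ⟨map_mem_of_mem_parab (f := α.toMonoidHom) (fun j hj => parab_mono (linkUp_subset hj) (h j)) hx,
      map_mem_of_mem_parab (f := (α⁻¹).toMonoidHom)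
        (fun j hj => parab_mono (linkUp_subset hj) (h' j)) hx⟩

theorem mem_linkPreserving_of_clean [Finite V] {α : MulAut (RAAG Γ)} (hα : α ∈ levelTwo Γ)
    (hc : ∀ s, CleanRow Γ α s) : α ∈ linkPreserving Γ :=
  mem_linkPreserving (map_gen_mem_parab_linkUp hα hc)
    (map_gen_mem_parab_linkUp (inv_mem hα) (CleanRow.inv hα hc))

variable [DecidableEq V]

theorem inversion_mem_linkPreserving (v : V) : inversion Γ v ∈ linkPreserving Γ := by
  have : ∀ i, inversion Γ v (gen Γ i) ∈ parab Γ (linkUp Γ i) := by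
    intro i
    have : gen Γ i ∈ parab Γ (linkUp Γ i) := gen_mem_parab (self_mem_linkUp i)
    rw [inversion_gen]
    split_ifs
    · exact inv_mem this
    · exact this
  exact mem_linkPreserving this (by rwa [inversion_inv])

theorem elementaryPalindromic_mem_linkPreserving {i j : V} (hij : i ≠ j) (h : j ∈ linkUp Γ i) :
    elementaryPalindromic Γ i j hij (dominates_of_mem_linkUp h) ∈ linkPreserving Γ := by
  refine mem_linkPreserving (fun u => ?_) (fun u => ?_)
  · have hu : gen Γ u ∈ parab Γ (linkUp Γ u) := gen_mem_parab (self_mem_linkUp u)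
    rw [elementaryPalindromic_gen]
    split_ifs with hui
    · subst hui
      exact mul_mem (mul_mem (gen_mem_parab h) hu) (gen_mem_parab h)
    · exact hu
  · have hu : gen Γ u ∈ parab Γ (linkUp Γ u) := gen_mem_parab (self_mem_linkUp u)
    rw [elementaryPalindromic_inv_gen]
    split_ifs with hui
    · subst hui
      exact mul_mem (mul_mem (inv_mem (gen_mem_parab h)) hu) (inv_mem (gen_mem_parab h))
    · exact hu

end LinkPreserving

end RAAG

/-! ### Normal forms and ping-pong in free products. -/

namespace FreeProductWords

open Monoid CoprodI

universe u v

variable {I : Type v} {G : I → Type u} [∀ i, Group (G i)]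

/-- The product of a list of syllables. -/
def listProd (l : List (Σ i, G i)) : CoprodI G := (l.map fun x => CoprodI.of x.2).prod

/-- A reduced list of syllables. -/
def Reduced (l : List (Σ i, G i)) : Prop :=
  (∀ x ∈ l, x.2 ≠ 1) ∧ l.IsChain fun a b => a.1 ≠ b.1

open Classical in
/-- The normal form of an element of a free product. -/
noncomputable def nf (p : CoprodI G) : List (Σ i, G i) := (Word.equiv p).toList

theorem reduced_nf (p : CoprodI G) : Reduced (nf p) := by
  classical
  exact ⟨fun x hx => (Word.equiv p).ne_one x hx, (Word.equiv p).chain_ne⟩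

theorem listProd_nf (p : CoprodI G) : listProd (nf p) = p := by
  classical
  exact Word.equiv.symm_apply_apply p

theorem nf_listProd {l : List (Σ i, G i)} (h : Reduced l) : nf (listProd l) = l := by
  classical
  have := Word.equiv.apply_symm_apply (⟨l, fun x hx => h.1 x hx, h.2⟩ : Word G)
  exact congrArg Word.toList this

theorem listProd_cons (x : Σ i, G i) (l : List (Σ i, G i)) :
    listProd (x :: l) = CoprodI.of x.2 * listProd l := by simp [listProd]

theorem listProd_append (l l' : List (Σ i, G i)) :
    listProd (l ++ l') = listProd l * listProd l' := by simp [listProd]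

theorem Reduced.tail {x : Σ i, G i} {l : List (Σ i, G i)} (h : Reduced (x :: l)) : Reduced l :=
  ⟨fun y hy => h.1 y (List.mem_cons_of_mem _ hy), (List.isChain_cons.1 h.2).2⟩

theorem reduced_cons {x : Σ i, G i} {l : List (Σ i, G i)} :
    Reduced (x :: l) ↔ x.2 ≠ 1 ∧ (∀ y ∈ l.head?, x.1 ≠ y.1) ∧ Reduced l := by
  constructor
  · exact fun h => ⟨h.1 x List.mem_cons_self, (List.isChain_cons.1 h.2).1, h.tail⟩
  · rintro ⟨h1, h2, h3⟩
    exact ⟨fun y hy => (List.mem_cons.1 hy).elim (fun h => h ▸ h1) (h3.1 y),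
      List.isChain_cons.2 ⟨h2, h3.2⟩⟩

theorem reduced_append {l l' : List (Σ i, G i)} :
    Reduced (l ++ l') ↔ Reduced l ∧ Reduced l' ∧
      ∀ x ∈ l.getLast?, ∀ y ∈ l'.head?, x.1 ≠ y.1 := by
  simp only [Reduced, List.isChain_append, List.mem_append]
  constructor
  · rintro ⟨h1, h2, h3, h4⟩
    exact ⟨⟨fun x hx => h1 x (Or.inl hx), h2⟩, ⟨fun x hx => h1 x (Or.inr hx), h3⟩, h4⟩
  · rintro ⟨⟨h1, h2⟩, ⟨h3, h4⟩, h5⟩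
    exact ⟨fun x hx => hx.elim (h1 x) (h3 x), h2, h4, h5⟩

theorem reduced_nil : Reduced ([] : List (Σ i, G i)) := ⟨by simp, List.isChain_nil⟩

theorem nf_one : nf (1 : CoprodI G) = [] := nf_listProd reduced_nil

theorem nf_of_mul {i : I} {x : G i} (hx : x ≠ 1) {p : CoprodI G}
    (h : ∀ y ∈ (nf p).head?, i ≠ y.1) : nf (CoprodI.of x * p) = ⟨i, x⟩ :: nf p := by
  conv_lhs => rw [← listProd_nf p]
  exact nf_listProd (l := ⟨i, x⟩ :: nf p) (reduced_cons.2 ⟨hx, h, reduced_nf p⟩)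

theorem nf_of {i : I} {x : G i} (hx : x ≠ 1) : nf (CoprodI.of x : CoprodI G) = [⟨i, x⟩] := by
  have := nf_of_mul hx (p := (1 : CoprodI G)) (by simp [nf_one])
  rwa [mul_one, nf_one] at this

theorem length_nf_of_mul_le {i : I} (x : G i) (p : CoprodI G) :
    (nf (CoprodI.of x * p)).length ≤ (nf p).length + 1 := by
  by_cases hx : x = 1
  · simp [hx]
  by_cases h : ∀ y ∈ (nf p).head?, i ≠ y.1
  · rw [nf_of_mul hx h]; simp
  · push Not at h
    obtain ⟨⟨j, y⟩, hy, rfl⟩ := h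
    obtain ⟨l, hl⟩ : ∃ l, nf p = ⟨i, y⟩ :: l := ⟨_, List.eq_cons_of_mem_head? hy⟩
    have hred := reduced_cons.1 (hl ▸ reduced_nf p)
    have hp : CoprodI.of x * p = CoprodI.of (x * y) * listProd l := by
      rw [← listProd_nf p, hl, listProd_cons, map_mul, mul_assoc]
    rw [hp, hl]
    by_cases hxy : x * y = 1
    · rw [hxy, map_one, one_mul, nf_listProd hred.2.2]; simp; omega
    · rw [nf_of_mul hxy (by rw [nf_listProd hred.2.2]; exact hred.2.1), nf_listProd hred.2.2]
      simp

theorem length_nf_listProd_le (l : List (Σ i, G i)) : (nf (listProd l)).length ≤ l.length := by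
  induction l with
  | nil => simp [listProd, nf_one]
  | cons x l ih =>
    rw [listProd_cons]
    exact (length_nf_of_mul_le _ _).trans (by simpa using ih)

section PingPong

variable {C : Type v} {G : Option C → Type u} [∀ i, Group (G i)] (t : ∀ c, G (some c))
  (W : C → CoprodI G)

/-- The elements whose normal form begins with that of `W c`, followed by the syllable `t c`. -/
def PrefixSet (c : C) (p : CoprodI G) : Prop := nf (W c) ++ [⟨some c, t c⟩] <+: nf p

variable {t W}

/-- If (W c)⁻¹p began in factor c, its first syllable would be t c and, as W c does not end in that
factor, p would already have the prefix. Otherwise nothing cancels. -/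
theorem PrefixSet.conj_mul (ht : ∀ c (x : G (some c)), x = 1 ∨ x = t c) (ht1 : ∀ c, t c ≠ 1)
    (hend : ∀ c, ∀ a ∈ (nf (W c)).getLast?, a.1 ≠ some c) {c : C} {p : CoprodI G}
    (h : ¬ PrefixSet t W c p) :
    PrefixSet t W c (W c * CoprodI.of (t c) * (W c)⁻¹ * p) := by
  have hq : ∀ y ∈ (nf ((W c)⁻¹ * p)).head?, some c ≠ y.1 := by
    rintro ⟨j, y⟩ hy rfl
    obtain ⟨l, hl⟩ : ∃ l, nf ((W c)⁻¹ * p) = ⟨some c, y⟩ :: l :=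
      ⟨_, List.eq_cons_of_mem_head? hy⟩
    apply h
    have hred := reduced_nf ((W c)⁻¹ * p)
    have hyt : y = t c :=
      (ht c y).resolve_left (hred.1 ⟨some c, y⟩ (by rw [hl]; exact List.mem_cons_self))
    have hp : p = listProd (nf (W c) ++ nf ((W c)⁻¹ * p)) := by
      rw [listProd_append, listProd_nf, listProd_nf, mul_inv_cancel_left]
    have hnp : nf p = nf (W c) ++ nf ((W c)⁻¹ * p) := by
      conv_lhs => rw [hp]
      refine nf_listProd (reduced_append.2 ⟨reduced_nf _, hred, fun a ha b hb => ?_⟩)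
      rw [Option.mem_unique hb hy]
      exact hend c a ha
    rw [PrefixSet, hnp, hl, hyt]
    exact ⟨l, by simp⟩
  have h1 := nf_of_mul (ht1 c) hq
  have h2 : W c * CoprodI.of (t c) * (W c)⁻¹ * p =
      listProd (nf (W c) ++ nf (CoprodI.of (t c) * ((W c)⁻¹ * p))) := by
    rw [listProd_append, listProd_nf, listProd_nf]; simp only [mul_assoc]
  rw [PrefixSet, h2, nf_listProd, h1]
  · exact ⟨nf ((W c)⁻¹ * p), by simp⟩
  · refine reduced_append.2 ⟨reduced_nf _, reduced_nf _, fun a ha b hb => ?_⟩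
    rw [h1, List.head?_cons, Option.mem_def, Option.some.injEq] at hb
    rw [← hb]
    exact hend c a ha

/-- Two prefixes of one word are comparable: they agree in the last syllable or one sits inside the
other W, which `hpre` forbids. -/
theorem PrefixSet.unique
    (hpre : ∀ c c', c ≠ c' → ¬ nf (W c) ++ [⟨some c, t c⟩] <+: nf (W c')) {c c' : C}
    {p : CoprodI G} (h : PrefixSet t W c p) (h' : PrefixSet t W c' p) : c = c' := by
  by_contra hne
  rcases List.prefix_or_prefix_of_prefix h h' with h1 | h1
  · rcases List.prefix_concat_iff.1 (by simpa using h1) with h2 | h2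
    · have := (List.append_inj' h2 rfl).2
      simp only [List.cons.injEq, Sigma.mk.injEq, Option.some.injEq] at this
      exact hne this.1.1
    · exact hpre c c' hne h2
  · rcases List.prefix_concat_iff.1 (by simpa using h1) with h2 | h2
    · have := (List.append_inj' h2 rfl).2
      simp only [List.cons.injEq, Sigma.mk.injEq, Option.some.injEq] at this
      exact hne this.1.1.symm
    · exact hpre c' c (Ne.symm hne) h2

theorem PrefixSet.head_ne_none (hstart : ∀ c, ∀ a ∈ (nf (W c)).head?, a.1 ≠ none) {c : C}
    {p : CoprodI G} (h : PrefixSet t W c p) : ∀ y ∈ (nf p).head?, none ≠ y.1 := by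
  obtain ⟨l, hl⟩ := h
  intro y hy
  rw [← hl] at hy
  cases hW : nf (W c) with
  | nil => rw [hW] at hy; simp at hy; rw [← hy]; simp
  | cons a w =>
    rw [hW] at hy
    simp only [List.cons_append, List.head?_cons, Option.mem_def, Option.some.injEq] at hy
    rw [← hy]
    exact (hstart c a (by simp [hW])).symm

theorem PrefixSet.not_of_head {c : C} {p : CoprodI G} {b : G none} {l : List (Σ i, G i)}
    (hstart : ∀ c, ∀ a ∈ (nf (W c)).head?, a.1 ≠ none)
    (hp : nf p = ⟨none, b⟩ :: l) : ¬ PrefixSet t W c p := fun h =>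
  h.head_ne_none hstart ⟨none, b⟩ (by simp [hp]) rfl

/-- Ping-pong: an endomorphism fixing the first factor and conjugating the involutions `t c` by
elements `W c` without possible shortening can only be surjective if all `W c` are trivial. -/
theorem eq_one_of_mem_range (ht : ∀ c (x : G (some c)), x = 1 ∨ x = t c) (ht1 : ∀ c, t c ≠ 1)
    (hend : ∀ c, ∀ a ∈ (nf (W c)).getLast?, a.1 ≠ some c)
    (hstart : ∀ c, ∀ a ∈ (nf (W c)).head?, a.1 ≠ none)
    (hpre : ∀ c c', c ≠ c' → ¬ nf (W c) ++ [⟨some c, t c⟩] <+: nf (W c'))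
    (θ : CoprodI G →* CoprodI G) (hθ : ∀ b : G none, θ (CoprodI.of b) = CoprodI.of b)
    (hθt : ∀ c, θ (CoprodI.of (t c)) = W c * CoprodI.of (t c) * (W c)⁻¹) {c : C}
    (hc : CoprodI.of (t c) ∈ θ.range) : W c = 1 := by
  -- The first syllable of a reduced word determines where its image under θ starts.
  have key : ∀ l : List (Σ i, G i), Reduced l → l = [] ∨
      (∃ b l', l = ⟨none, b⟩ :: l' ∧ ∃ m, nf (θ (listProd l)) = ⟨none, b⟩ :: m) ∨
      ∃ c x l', l = ⟨some c, x⟩ :: l' ∧ PrefixSet t W c (θ (listProd l)) := by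
    intro l
    induction l with
    | nil => exact fun _ => Or.inl rfl
    | cons a l ih =>
      intro hred
      obtain ⟨h1, h2, h3⟩ := reduced_cons.1 hred
      right
      obtain ⟨i, x⟩ := a
      cases i with
      | none =>
        left
        refine ⟨x, l, rfl, nf (θ (listProd l)), ?_⟩
        rw [listProd_cons, map_mul, hθ]
        refine nf_of_mul h1 ?_
        rcases ih h3 with rfl | ⟨b, l', rfl, -⟩ | ⟨c, y, l', rfl, h⟩
        · simp [listProd, nf_one]
        · exact absurd rfl (h2 ⟨none, b⟩ rfl)
        · exact h.head_ne_none hstart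
      | some c =>
        right
        refine ⟨c, x, l, rfl, ?_⟩
        rw [(ht c x).resolve_left h1, listProd_cons, map_mul, hθt]
        refine PrefixSet.conj_mul ht ht1 hend ?_
        rcases ih h3 with rfl | ⟨b, l', rfl, m, hm⟩ | ⟨c', y, l', rfl, h⟩
        · simp [PrefixSet, listProd, nf_one]
        · exact PrefixSet.not_of_head hstart hm
        · intro h'
          have := PrefixSet.unique hpre h' h
          subst this
          exact h2 ⟨some c, y⟩ rfl rfl
  obtain ⟨h, hh⟩ := hc
  rw [← listProd_nf h] at hh
  rcases key (nf h) (reduced_nf h) with h0 | ⟨b, l', -, m, hm⟩ | ⟨c', x, l', -, h1⟩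
  · rw [h0] at hh
    have := congrArg nf hh
    rw [nf_of (ht1 c)] at this
    simp [listProd, nf_one] at this
  · rw [hh, nf_of (ht1 c)] at hm
    simp at hm
  · rw [hh, PrefixSet, nf_of (ht1 c)] at h1
    -- The image is a single syllable, so the prefix W c' has no room.
    have hlen := h1.length_le
    simp only [List.length_append, List.length_cons, List.length_nil] at hlen
    have hnil : nf (W c') = [] := List.length_eq_zero_iff.1 (by omega)
    rw [hnil, List.nil_append] at h1
    have := h1.eq_of_length rfl
    simp only [List.cons.injEq, Sigma.mk.injEq, Option.some.injEq] at this
    obtain ⟨⟨rfl, -⟩, -⟩ := this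
    rw [← listProd_nf (W c'), hnil]; rfl

end PingPong

end FreeProductWords

namespace RAAG

open Monoid FreeProductWords

/-! ### The free product attached to a link class. -/

section LinkClass

universe u

variable {V : Type u} (Γ : SimpleGraph V) (i₀ : V)

/-- The vertices with the same link as `i₀`. -/
abbrev LinkClass : Type u := {c : V // Γ.neighborSet c = Γ.neighborSet i₀}

/-- The holomorph of the right-angled Artin group. -/
abbrev Hol : Type u := RAAG Γ ⋊[MonoidHom.id (MulAut (RAAG Γ))] MulAut (RAAG Γ)

/-- The hyperelliptic involution in the holomorph. -/
def holInv : Hol Γ := SemidirectProduct.inr (invAll Γ)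

/-- The involution attached to a vertex. -/
def holRefl (v : V) : Hol Γ := SemidirectProduct.inl (gen Γ v) * holInv Γ

variable {Γ} in
theorem holInv_mul_inl (x : RAAG Γ) :
    holInv Γ * SemidirectProduct.inl x = SemidirectProduct.inl (invAll Γ x) * holInv Γ := by
  have := SemidirectProduct.inl_aut (φ := MonoidHom.id (MulAut (RAAG Γ))) (invAll Γ) x
  rw [MonoidHom.id_apply] at this
  rw [this, holInv, map_inv, inv_mul_cancel_right]

theorem holInv_mul_holInv : holInv Γ * holInv Γ = 1 := by
  rw [holInv, ← map_mul]
  have : invAll Γ * invAll Γ = 1 := MulEquiv.ext fun x => invAll_invAll Γ x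
  rw [this, map_one]

theorem holRefl_mul_holRefl (v : V) : holRefl Γ v * holRefl Γ v = 1 := by
  rw [holRefl, mul_assoc, ← mul_assoc (holInv Γ), holInv_mul_inl, mul_assoc, holInv_mul_holInv,
    mul_one, ← map_mul, invAll_gen, mul_inv_cancel, map_one]

theorem holRefl_ne_one (v : V) : holRefl Γ v ≠ 1 := by
  intro h
  have h1 := congrArg SemidirectProduct.left h
  have h2 : (holRefl Γ v).left = gen Γ v := by simp [holRefl, holInv]
  rw [h2] at h1
  have h3 := congrArg (ex Γ v) h1
  rw [ex_gen_self] at h3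
  simp at h3

/-- The factors of the free product acting on the tree of a link class. -/
def factor : Option (LinkClass Γ i₀) → Subgroup (Hol Γ)
  | none => Subgroup.closure (insert (holInv Γ)
      {x | ∃ v, v ∈ linkUp Γ i₀ ∧ Γ.neighborSet v ≠ Γ.neighborSet i₀ ∧
        x = SemidirectProduct.inl (gen Γ v)})
  | some c => Subgroup.zpowers (holRefl Γ c)

/-- The free product of the factors. -/
abbrev FactorProd : Type u := CoprodI fun i => factor Γ i₀ i

/-- The involution attached to a vertex of the link class, in its factor. -/
def refl (c : LinkClass Γ i₀) : factor Γ i₀ (some c) :=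
  ⟨holRefl Γ c, Subgroup.mem_zpowers _⟩

theorem refl_ne_one (c : LinkClass Γ i₀) : refl Γ i₀ c ≠ 1 := fun h =>
  holRefl_ne_one Γ c (congrArg Subtype.val h)

theorem refl_mul_refl (c : LinkClass Γ i₀) : refl Γ i₀ c * refl Γ i₀ c = 1 :=
  Subtype.ext (holRefl_mul_holRefl Γ c)

theorem eq_one_or_eq_refl (c : LinkClass Γ i₀) (x : factor Γ i₀ (some c)) :
    x = 1 ∨ x = refl Γ i₀ c := by
  obtain ⟨x, n, rfl⟩ := x
  have h2 : (holRefl Γ c) ^ (2 : ℤ) = 1 := by rw [zpow_two, holRefl_mul_holRefl]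
  rcases Int.even_or_odd' n with ⟨k, rfl | rfl⟩
  · left; apply Subtype.ext; simp [zpow_mul, h2]
  · right; apply Subtype.ext; simp [zpow_add, zpow_mul, h2, refl]

/-- The embedding of the first factor. -/
abbrev freeOf : factor Γ i₀ none →* FactorProd Γ i₀ :=
  CoprodI.of (M := fun i => factor Γ i₀ i) (i := none)

/-- The involution in the free product, from the first factor. -/
def freeInv : FactorProd Γ i₀ :=
  freeOf Γ i₀ (⟨holInv Γ, Subgroup.subset_closure (Set.mem_insert _ _)⟩ :
    factor Γ i₀ none)

/-- The involution of a vertex in the free product. -/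
def freeRefl (c : LinkClass Γ i₀) : FactorProd Γ i₀ :=
  CoprodI.of (M := fun i => factor Γ i₀ i) (refl Γ i₀ c)

@[simp] theorem freeInv_mul_self : freeInv Γ i₀ * freeInv Γ i₀ = 1 := by
  rw [freeInv, ← map_mul]
  convert map_one (freeOf Γ i₀) using 2
  exact Subtype.ext (holInv_mul_holInv Γ)

@[simp] theorem freeRefl_mul_self (c : LinkClass Γ i₀) : freeRefl Γ i₀ c * freeRefl Γ i₀ c = 1 := by
  rw [freeRefl, ← map_mul, refl_mul_refl, map_one]

@[simp] theorem freeInv_mul_self_assoc (x : FactorProd Γ i₀) :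
    freeInv Γ i₀ * (freeInv Γ i₀ * x) = x := by rw [← mul_assoc]; simp

@[simp] theorem freeRefl_mul_self_assoc (c : LinkClass Γ i₀) (x : FactorProd Γ i₀) :
    freeRefl Γ i₀ c * (freeRefl Γ i₀ c * x) = x := by rw [← mul_assoc]; simp

@[simp] theorem freeInv_inv : (freeInv Γ i₀)⁻¹ = freeInv Γ i₀ :=
  inv_eq_of_mul_eq_one_left (freeInv_mul_self Γ i₀)

@[simp] theorem freeRefl_inv (c : LinkClass Γ i₀) : (freeRefl Γ i₀ c)⁻¹ = freeRefl Γ i₀ c :=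
  inv_eq_of_mul_eq_one_left (freeRefl_mul_self Γ i₀ c)

/-- A vertex whose link strictly contains the link of `i₀`, in the first factor. -/
def upper (v : V) (hv : v ∈ linkUp Γ i₀) (hne : Γ.neighborSet v ≠ Γ.neighborSet i₀) :
    factor Γ i₀ none :=
  ⟨SemidirectProduct.inl (gen Γ v), Subgroup.subset_closure (Or.inr ⟨v, hv, hne, rfl⟩)⟩

open Classical in
/-- The homomorphism to the free product that is faithful on the vertices whose link contains that
of `i₀` and kills the other vertices. -/
noncomputable def toFree : RAAG Γ →* FactorProd Γ i₀ :=
  lift (fun v => if h : Γ.neighborSet v = Γ.neighborSet i₀ then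
      freeRefl Γ i₀ ⟨v, h⟩ * freeInv Γ i₀
    else if hv : v ∈ linkUp Γ i₀ then freeOf Γ i₀ (upper Γ i₀ v hv h) else 1) (by
    -- A vertex of the class has no neighbour in `linkUp Γ i₀`: such a neighbour would be adjacent
    -- to itself.
    have key : ∀ u v, Γ.Adj u v → Γ.neighborSet u = Γ.neighborSet i₀ → v ∉ linkUp Γ i₀ := by
      intro u v huv hu hv
      have : v ∈ Γ.neighborSet i₀ := hu ▸ huv
      exact Γ.irrefl (hv this)
    have key' : ∀ v, Γ.neighborSet v = Γ.neighborSet i₀ → v ∈ linkUp Γ i₀ := fun v hv =>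
      hv.symm.subset
    intro u v huv
    split_ifs with h1 h2 h3 h4 h5 h6 h7 <;>
      first
      | exact Commute.one_left _
      | exact Commute.one_right _
      | exact absurd (key' _ ‹_›) (key u v huv h1)
      | exact absurd ‹_› (key u v huv h1)
      | exact absurd ‹_› (key v u huv.symm ‹_›)
      | exact Commute.map (Subtype.ext ((commute_gen Γ huv).map SemidirectProduct.inl).eq :
          Commute (upper Γ i₀ u ‹_› ‹_›) (upper Γ i₀ v ‹_› ‹_›)) (freeOf Γ i₀))

variable {Γ i₀}

theorem toFree_class (c : LinkClass Γ i₀) :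
    toFree Γ i₀ (gen Γ (c : V)) = freeRefl Γ i₀ c * freeInv Γ i₀ := by
  simp [toFree, c.2]

theorem toFree_upper {v : V} (hv : v ∈ linkUp Γ i₀) (hne : Γ.neighborSet v ≠ Γ.neighborSet i₀) :
    toFree Γ i₀ (gen Γ v) = freeOf Γ i₀ (upper Γ i₀ v hv hne) := by
  simp [toFree, hne, hv]

theorem toFree_of_notMem {v : V} (hv : v ∉ linkUp Γ i₀) : toFree Γ i₀ (gen Γ v) = 1 := by
  have : Γ.neighborSet v ≠ Γ.neighborSet i₀ := fun h => hv h.symm.subset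
  simp [toFree, this, hv]

theorem freeInv_mul_toFree (x : RAAG Γ) :
    freeInv Γ i₀ * toFree Γ i₀ x = toFree Γ i₀ (invAll Γ x) * freeInv Γ i₀ := by
  have : (MulAut.conj (freeInv Γ i₀)).toMonoidHom.comp (toFree Γ i₀) =
      (toFree Γ i₀).comp (invAll Γ).toMonoidHom := hom_ext fun v => by
    by_cases h : Γ.neighborSet v = Γ.neighborSet i₀
    · have := toFree_class (Γ := Γ) (i₀ := i₀) ⟨v, h⟩
      simp only at this
      simp [this, mul_assoc]
    · by_cases hv : v ∈ linkUp Γ i₀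
      · have h1 : freeInv Γ i₀ * freeOf Γ i₀ (upper Γ i₀ v hv h) =
            (freeOf Γ i₀ (upper Γ i₀ v hv h))⁻¹ * freeInv Γ i₀ := by
          rw [freeInv, ← map_inv, ← map_mul, ← map_mul]
          exact congrArg _ (Subtype.ext (by simpa [upper] using holInv_mul_inl (gen Γ v)))
        simp [toFree_upper hv h, h1, mul_assoc]
      · simp [toFree_of_notMem hv]
  have := DFunLike.congr_fun this x
  simp only [MonoidHom.comp_apply, MulEquiv.coe_toMonoidHom, MulAut.conj_apply] at this
  rw [← this]; simp [mul_assoc]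

/-- Evaluation of the free product in the holomorph. -/
noncomputable def evalFree : FactorProd Γ i₀ →* Hol Γ :=
  CoprodI.lift fun i => (factor Γ i₀ i).subtype

/-- This makes `toFree` injective on the subgroup in question, since `inl` is injective. -/
theorem evalFree_toFree {x : RAAG Γ} (hx : x ∈ parab Γ (linkUp Γ i₀)) :
    evalFree (toFree Γ i₀ x) = SemidirectProduct.inl x := by
  refine eq_of_mem_parab (f := evalFree.comp (toFree Γ i₀)) (g := SemidirectProduct.inl)
    (fun v hv => ?_) hx
  by_cases h : Γ.neighborSet v = Γ.neighborSet i₀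
  · have := toFree_class (Γ := Γ) (i₀ := i₀) ⟨v, h⟩
    simp only at this
    rw [MonoidHom.comp_apply, this, map_mul, evalFree, freeRefl, freeInv, CoprodI.lift_of (M := fun i => factor Γ i₀ i),
      CoprodI.lift_of (M := fun i => factor Γ i₀ i)]
    simp [refl, holRefl, mul_assoc, holInv_mul_holInv]
  · rw [MonoidHom.comp_apply, toFree_upper hv h, evalFree, CoprodI.lift_of]
    rfl

/-- The endomorphism of the free product induced by a family of conjugations. -/
noncomputable def conjEnd (W : LinkClass Γ i₀ → FactorProd Γ i₀) :
    FactorProd Γ i₀ →* FactorProd Γ i₀ :=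
  CoprodI.lift fun i => match i with
    | none => freeOf Γ i₀
    | some c => (MulAut.conj (W c)).toMonoidHom.comp (CoprodI.of (M := fun i => factor Γ i₀ i))

theorem conjEnd_of (W : LinkClass Γ i₀ → FactorProd Γ i₀) (b : factor Γ i₀ none) :
    conjEnd W (freeOf Γ i₀ b) = freeOf Γ i₀ b :=
  CoprodI.lift_of (M := fun i => factor Γ i₀ i) _ b

theorem conjEnd_refl (W : LinkClass Γ i₀ → FactorProd Γ i₀) (c : LinkClass Γ i₀) :
    conjEnd W (freeRefl Γ i₀ c) = W c * freeRefl Γ i₀ c * (W c)⁻¹ :=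
  CoprodI.lift_of (M := fun i => factor Γ i₀ i) _ (refl Γ i₀ c)

section Moves

variable [DecidableEq V]

/-- `γ` is a modification of `α` on the link class, with conjugating elements `W`. -/
structure Modification (α γ : MulAut (RAAG Γ)) (W : LinkClass Γ i₀ → FactorProd Γ i₀) : Prop where
  mem : γ ∈ palGroup Γ
  pres : α * γ ∈ linkPreserving Γ
  eq : ∀ v, Γ.neighborSet v ≠ Γ.neighborSet i₀ → (α * γ) (gen Γ v) = α (gen Γ v)
  conj : ∀ c : LinkClass Γ i₀, toFree Γ i₀ ((α * γ) (gen Γ (c : V))) * freeInv Γ i₀ =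
    W c * freeRefl Γ i₀ c * (W c)⁻¹

variable {α γ : MulAut (RAAG Γ)} {W : LinkClass Γ i₀ → FactorProd Γ i₀}

theorem Modification.congr (h : Modification α γ W) {W' : LinkClass Γ i₀ → FactorProd Γ i₀}
    (hW : ∀ c : LinkClass Γ i₀, W' c * freeRefl Γ i₀ c * (W' c)⁻¹ = W c * freeRefl Γ i₀ c * (W c)⁻¹) :
    Modification α γ W' :=
  ⟨h.mem, h.pres, h.eq, fun c => by rw [h.conj, hW]⟩

/-- Changing the automorphism at one vertex of the class. -/
theorem Modification.mul (h : Modification α γ W) {δ : MulAut (RAAG Γ)} (hδ : δ ∈ palGroup Γ)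
    (hp : δ ∈ linkPreserving Γ) (c : LinkClass Γ i₀)
    (he : ∀ v : V, v ≠ (c : V) → (α * γ * δ) (gen Γ v) = (α * γ) (gen Γ v)) {w : FactorProd Γ i₀}
    (hw : toFree Γ i₀ ((α * γ * δ) (gen Γ (c : V))) * freeInv Γ i₀ =
      w * (W c * freeRefl Γ i₀ c * (W c)⁻¹) * w⁻¹) :
    Modification α (γ * δ) (Function.update W c (w * W c)) := by
  refine ⟨mul_mem h.mem hδ, ?_, fun v hv => ?_, fun d => ?_⟩
  · rw [← mul_assoc]; exact mul_mem h.pres hp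
  · rw [← mul_assoc, he v (by rintro rfl; exact hv c.2), h.eq v hv]
  · rw [← mul_assoc]
    by_cases hd : d = c
    · subst hd
      rw [hw, Function.update_self]; group
    · rw [he d (fun h => hd (Subtype.ext h)), h.conj, Function.update_of_ne hd]

theorem Modification.toFree_eq (h : Modification α γ W) (c : LinkClass Γ i₀) :
    toFree Γ i₀ ((α * γ) (gen Γ (c : V))) = W c * freeRefl Γ i₀ c * (W c)⁻¹ * freeInv Γ i₀ := by
  rw [← h.conj, mul_assoc, freeInv_mul_self, mul_one]

theorem Modification.inv_move (h : Modification α γ W) (c : LinkClass Γ i₀) :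
    ∃ γ', Modification α γ' (Function.update W c (freeInv Γ i₀ * W c)) := by
  refine ⟨_, h.mul (inversion_mem (c : V)) (inversion_mem_linkPreserving (c : V)) c (fun v hv => ?_) ?_⟩
  · rw [mul_inversion_gen, if_neg hv]
  · rw [mul_inversion_gen, if_pos rfl, map_inv, h.toFree_eq]
    simp [mul_assoc]

/-- With x the image of v, the image of c becomes x·y·x; as ιx = x⁻¹ι, the product xyx·ι is
x(yι)x⁻¹. -/
theorem Modification.gen_move (h : Modification α γ W) (hα : α ∈ purePalindromicAut Γ)
    (c : LinkClass Γ i₀) {v : V} (hv : v ∈ linkUp Γ i₀) (hvc : (c : V) ≠ v) :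
    (∃ γ', Modification α γ' (Function.update W c (toFree Γ i₀ ((α * γ) (gen Γ v)) * W c))) ∧
      ∃ γ', Modification α γ'
        (Function.update W c ((toFree Γ i₀ ((α * γ) (gen Γ v)))⁻¹ * W c)) := by
  have hv' : v ∈ linkUp Γ (c : V) := by
    change Γ.neighborSet c ⊆ _
    rw [c.2]; exact hv
  have hinv : freeInv Γ i₀ * toFree Γ i₀ ((α * γ) (gen Γ v)) =
      (toFree Γ i₀ ((α * γ) (gen Γ v)))⁻¹ * freeInv Γ i₀ := by
    rw [freeInv_mul_toFree, levelTwo.invAll_eq (purePalindromicAut_subset_levelTwo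
      (mul_mem_purePalindromicAut hα h.mem)) v, map_inv]
  have hinv' : freeInv Γ i₀ * (toFree Γ i₀ ((α * γ) (gen Γ v)))⁻¹ =
      toFree Γ i₀ ((α * γ) (gen Γ v)) * freeInv Γ i₀ := by
    rw [← mul_inv_eq_iff_eq_mul, freeInv_inv, mul_assoc, ← eq_inv_mul_iff_mul_eq, freeInv_inv, hinv]
  constructor
  · refine ⟨_, h.mul (elementaryPalindromic_mem (c : V) v hvc (dominates_of_mem_linkUp hv'))
      (elementaryPalindromic_mem_linkPreserving hvc hv') c (fun u hu => ?_) ?_⟩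
    · rw [mul_elementaryPalindromic_gen, if_neg hu]
    · rw [mul_elementaryPalindromic_gen, if_pos rfl, map_mul, map_mul, h.toFree_eq]
      simp only [mul_assoc, hinv]
      simp
  · refine ⟨_, h.mul (inv_mem (elementaryPalindromic_mem (c : V) v hvc (dominates_of_mem_linkUp hv')))
      (inv_mem (elementaryPalindromic_mem_linkPreserving hvc hv')) c (fun u hu => ?_) ?_⟩
    · rw [mul_elementaryPalindromic_inv_gen, if_neg hu]
    · rw [mul_elementaryPalindromic_inv_gen, if_pos rfl, map_mul, map_mul, map_inv, h.toFree_eq]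
      simp only [mul_assoc, hinv']
      simp

end Moves

end LinkClass

end RAAG

namespace RAAG

open Monoid FreeProductWords

/-! ### Length reduction on a link class. -/

section LinkClassReduction

universe u

variable {V : Type u} {Γ : SimpleGraph V} {i₀ : V} [DecidableEq V]
  {α γ : MulAut (RAAG Γ)} {W : LinkClass Γ i₀ → FactorProd Γ i₀}

/-- Inversions supply ι, and since the vertices of strictly larger link are fixed, transvections by
them supply the other generators of the first factor. -/
theorem Modification.factor_move (h : Modification α γ W) (hα : α ∈ purePalindromicAut Γ)
    (hfix : ∀ v ∈ linkUp Γ i₀, Γ.neighborSet v ≠ Γ.neighborSet i₀ → α (gen Γ v) = gen Γ v)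
    (c : LinkClass Γ i₀) (b : factor Γ i₀ none) :
    ∃ γ', Modification α γ' (Function.update W c (freeOf Γ i₀ b * W c)) := by
  have hup : ∀ {γ : MulAut (RAAG Γ)} {W : LinkClass Γ i₀ → FactorProd Γ i₀},
      Modification α γ W → ∀ v (hv : v ∈ linkUp Γ i₀)
      (hne : Γ.neighborSet v ≠ Γ.neighborSet i₀),
      toFree Γ i₀ ((α * γ) (gen Γ v)) = freeOf Γ i₀ (upper Γ i₀ v hv hne) := by
    intro γ W h v hv hne
    rw [h.eq v hne, hfix v hv hne, toFree_upper hv hne]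
  have hne' : ∀ v : V, Γ.neighborSet v ≠ Γ.neighborSet i₀ → (c : V) ≠ v := by
    rintro v hv rfl; exact hv c.2
  obtain ⟨b, hb⟩ := b
  induction hb using Subgroup.closure_induction_right generalizing γ W with
  | one =>
    refine ⟨γ, h.congr fun d => ?_⟩
    by_cases hd : d = c
    · subst hd
      have : freeOf Γ i₀ ⟨1, one_mem _⟩ = 1 := map_one _
      rw [Function.update_self]
      erw [this]
      rw [one_mul]
    · rw [Function.update_of_ne hd]
  | mul_right x hx y hy ih =>
    have hyK : y ∈ factor Γ i₀ none := Subgroup.subset_closure hy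
    have hmul : freeOf Γ i₀ ⟨x * y, mul_mem hx hyK⟩ =
      freeOf Γ i₀ ⟨x, hx⟩ * freeOf Γ i₀ ⟨y, hyK⟩ := map_mul (freeOf Γ i₀) ⟨x, hx⟩ ⟨y, hyK⟩
    have : ∃ γ', Modification α γ' (Function.update W c (freeOf Γ i₀ ⟨y, hyK⟩ * W c)) := by
      rcases hy with rfl | ⟨v, hv, hne, rfl⟩
      · exact h.inv_move c
      · have := (h.gen_move hα c hv (hne' v hne)).1
        rwa [hup h v hv hne] at this
    obtain ⟨γ', h'⟩ := this
    obtain ⟨γ'', h''⟩ := ih h'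
    refine ⟨γ'', ?_⟩
    rw [Function.update_idem, Function.update_self, ← mul_assoc, ← hmul] at h''
    exact h''
  | mul_inv_cancel x hx y hy ih =>
    have hyK : y ∈ factor Γ i₀ none := Subgroup.subset_closure hy
    have hmul : freeOf Γ i₀ ⟨x * y⁻¹, mul_mem hx (inv_mem hyK)⟩ =
      freeOf Γ i₀ ⟨x, hx⟩ * (freeOf Γ i₀ ⟨y, hyK⟩)⁻¹ := by
      rw [← map_inv]; exact map_mul (freeOf Γ i₀) ⟨x, hx⟩ (⟨y, hyK⟩)⁻¹
    have : ∃ γ', Modification α γ' (Function.update W c ((freeOf Γ i₀ ⟨y, hyK⟩)⁻¹ * W c)) := by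
      rcases hy with rfl | ⟨v, hv, hne, rfl⟩
      · have := h.inv_move c
        rw [← freeInv_inv] at this
        exact this
      · have := (h.gen_move hα c hv (hne' v hne)).2
        rwa [hup h v hv hne] at this
    obtain ⟨γ', h'⟩ := this
    obtain ⟨γ'', h''⟩ := ih h'
    refine ⟨γ'', ?_⟩
    rw [Function.update_idem, Function.update_self, ← mul_assoc, ← hmul] at h''
    exact h''

/-- Multiply by ι and then by the image of d; the two copies of ι cancel. -/
theorem Modification.conj_move (h : Modification α γ W) (hα : α ∈ purePalindromicAut Γ)
    {c d : LinkClass Γ i₀} (hcd : c ≠ d) :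
    ∃ γ', Modification α γ'
      (Function.update W c (W d * freeRefl Γ i₀ d * (W d)⁻¹ * W c)) := by
  obtain ⟨γ', h'⟩ := h.inv_move c
  obtain ⟨γ'', h''⟩ := (h'.gen_move hα c (v := d) d.2.symm.subset
    (fun he => hcd (Subtype.ext he))).1
  refine ⟨γ'', ?_⟩
  rw [h'.toFree_eq, Function.update_of_ne hcd.symm, Function.update_idem,
    Function.update_self, mul_assoc _ (freeInv Γ i₀), freeInv_mul_self_assoc] at h''
  exact h''

theorem exists_modification (hα : α ∈ purePalindromicAut Γ) (hp : α ∈ linkPreserving Γ) :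
    ∃ W : LinkClass Γ i₀ → FactorProd Γ i₀, Modification α 1 W := by
  have : ∀ c : LinkClass Γ i₀, ∃ w : FactorProd Γ i₀,
      toFree Γ i₀ (α (gen Γ (c : V))) * freeInv Γ i₀ = w * freeRefl Γ i₀ c * w⁻¹ := by
    intro c
    have hinv : ∀ g : RAAG Γ, (toFree Γ i₀ (invAll Γ g))⁻¹ * freeInv Γ i₀ =
        freeInv Γ i₀ * (toFree Γ i₀ g)⁻¹ := by
      intro g
      rw [inv_mul_eq_iff_eq_mul, ← mul_assoc, ← freeInv_mul_toFree]; simp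
    obtain ⟨g, hg | hg⟩ := mem_purePalindromicAut_iff.1 hα c
    · refine ⟨toFree Γ i₀ g, ?_⟩
      rw [hg, map_mul, map_mul, map_inv, toFree_class, mul_assoc, hinv]
      simp [mul_assoc]
    -- The extra ι accounts for v⁻¹ι = ι(vι)ι.
    · refine ⟨toFree Γ i₀ g * freeInv Γ i₀, ?_⟩
      rw [hg, map_mul, map_mul, map_inv, map_inv, toFree_class, mul_assoc, hinv]
      simp [mul_assoc]
  choose W hW using this
  exact ⟨W, one_mem _, by simpa using hp, fun v _ => by simp, fun c => by simpa using hW c⟩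

theorem Modification.map_gen_eq_of_eq_one (h : Modification α γ W) (c : LinkClass Γ i₀)
    (hW : W c = 1) : (α * γ) (gen Γ (c : V)) = gen Γ (c : V) := by
  have hmem : gen Γ (c : V) ∈ parab Γ (linkUp Γ i₀) := gen_mem_parab c.2.symm.subset
  have h1 := h.toFree_eq c
  rw [hW, one_mul, inv_one, mul_one, ← toFree_class] at h1
  have h2 := congrArg evalFree h1
  rw [evalFree_toFree hmem, evalFree_toFree (h.pres i₀ _ hmem).1] at h2
  exact SemidirectProduct.inl_injective h2

/-- `conjEnd W` realizes α * γ on the preserved subgroup, and the inverse of α * γ preserves it too,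
so preimages of its vertices exist there. -/
theorem Modification.freeRefl_mem_range (h : Modification α γ W)
    (hfix : ∀ v ∈ linkUp Γ i₀, Γ.neighborSet v ≠ Γ.neighborSet i₀ → α (gen Γ v) = gen Γ v)
    (c : LinkClass Γ i₀) : freeRefl Γ i₀ c ∈ (conjEnd W).range := by
  have hmem : gen Γ (c : V) ∈ parab Γ (linkUp Γ i₀) := gen_mem_parab c.2.symm.subset
  have key := eq_of_mem_parab (f := (conjEnd W).comp (toFree Γ i₀))
    (g := (toFree Γ i₀).comp (α * γ).toMonoidHom) (S := linkUp Γ i₀) (fun v hv => by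
      by_cases hne : Γ.neighborSet v = Γ.neighborSet i₀
      · have h1 := h.toFree_eq ⟨v, hne⟩
        have h2 := toFree_class (Γ := Γ) (i₀ := i₀) ⟨v, hne⟩
        simp only at h1 h2
        simp only [MonoidHom.comp_apply, MulEquiv.coe_toMonoidHom]
        rw [h1, h2, map_mul, conjEnd_refl, freeInv, conjEnd_of]
      · simp only [MonoidHom.comp_apply, MulEquiv.coe_toMonoidHom]
        rw [h.eq v hne, hfix v hv hne, toFree_upper hv hne, conjEnd_of])
    (h.pres i₀ _ hmem).2
  refine ⟨toFree Γ i₀ ((α * γ)⁻¹ (gen Γ (c : V))) * freeInv Γ i₀, ?_⟩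
  simp only [MonoidHom.comp_apply, MulEquiv.coe_toMonoidHom, MulAut.apply_inv_self] at key
  rw [map_mul, key, toFree_class, freeInv, conjEnd_of, ← freeInv, mul_assoc, freeInv_mul_self,
    mul_one]

theorem exists_fix_linkClass [Finite V] (hα : α ∈ purePalindromicAut Γ)
    (hp : α ∈ linkPreserving Γ)
    (hfix : ∀ v ∈ linkUp Γ i₀, Γ.neighborSet v ≠ Γ.neighborSet i₀ → α (gen Γ v) = gen Γ v) :
    ∃ γ ∈ palGroup Γ, α * γ ∈ linkPreserving Γ ∧
      (∀ v, Γ.neighborSet v ≠ Γ.neighborSet i₀ → (α * γ) (gen Γ v) = α (gen Γ v)) ∧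
      ∀ v, Γ.neighborSet v = Γ.neighborSet i₀ → (α * γ) (gen Γ v) = gen Γ v := by
  classical
  have : Fintype (LinkClass Γ i₀) := Fintype.ofFinite _
  let m : (LinkClass Γ i₀ → FactorProd Γ i₀) → ℕ := fun W => ∑ c, (nf (W c)).length
  obtain ⟨W, ⟨γ, h⟩, hmin⟩ := WellFounded.has_min (measure m).wf
    {W | ∃ γ, Modification α γ W} (by
      obtain ⟨W, h⟩ := exists_modification (i₀ := i₀) hα hp
      exact ⟨W, 1, h⟩)
  have hmin' : ∀ c (w : FactorProd Γ i₀), (∃ γ', Modification α γ' (Function.update W c w)) →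
      (nf (W c)).length ≤ (nf w).length := by
    intro c w hw
    by_contra! hlt
    refine hmin _ hw ?_
    change m _ < m _
    refine Finset.sum_lt_sum (fun d _ => ?_) ⟨c, Finset.mem_univ c, ?_⟩
    · by_cases hd : d = c
      · subst hd; rw [Function.update_self]; exact hlt.le
      · rw [Function.update_of_ne hd]
    · rw [Function.update_self]; exact hlt
  have hone : ∀ c, W c = 1 := by
    intro c
    refine eq_one_of_mem_range (t := refl Γ i₀) (W := W) (eq_one_or_eq_refl Γ i₀)
      (refl_ne_one Γ i₀) ?_ ?_ ?_ (conjEnd W) (conjEnd_of W) (conjEnd_refl W)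
      (h.freeRefl_mem_range hfix c)
    -- A final syllable in factor c commutes with the involution of c and can be dropped.
    · rintro c ⟨j, x⟩ ha rfl
      obtain ⟨l, hl⟩ := List.getLast?_eq_some_iff.1 ha
      have hx : x = refl Γ i₀ c := (eq_one_or_eq_refl Γ i₀ c x).resolve_left
        ((reduced_nf (W c)).1 ⟨some c, x⟩ (by rw [hl]; simp))
      have hW : W c = listProd l * freeRefl Γ i₀ c := by
        rw [← listProd_nf (W c), hl, listProd_append, hx]; simp [listProd, freeRefl]
      have hle := hmin' c (listProd l) ⟨γ, h.congr fun d => by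
        by_cases hd : d = c
        · subst hd
          rw [Function.update_self, hW]; simp [mul_assoc]
        · rw [Function.update_of_ne hd]⟩
      have := length_nf_listProd_le l
      rw [hl, List.length_append] at hle
      simp only [List.length_cons, List.length_nil] at hle
      omega
    -- An initial syllable in the first factor is removed by `factor_move`.
    · rintro c ⟨j, x⟩ ha rfl
      obtain ⟨l, hl⟩ : ∃ l, nf (W c) = ⟨none, x⟩ :: l := ⟨_, List.eq_cons_of_mem_head? ha⟩
      have hW : freeOf Γ i₀ x⁻¹ * W c = listProd l := by
        rw [← listProd_nf (W c), hl, listProd_cons, map_inv, inv_mul_cancel_left]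
      have hle := hmin' c _ (h.factor_move hα hfix c x⁻¹)
      have := length_nf_listProd_le l
      rw [hW, hl, List.length_cons] at hle
      omega
    -- An initial segment W d · t d is shortened to W d by `conj_move`, saving one syllable.
    · rintro d c hdc ⟨l, hl⟩
      have hW : W d * freeRefl Γ i₀ d * (W d)⁻¹ * W c = listProd (nf (W d) ++ l) := by
        rw [← listProd_nf (W c), ← hl, listProd_append, listProd_append, listProd_append,
          listProd_nf]
        have : listProd [(⟨some d, refl Γ i₀ d⟩ : Σ i, factor Γ i₀ i)] = freeRefl Γ i₀ d := by
          simp [listProd, freeRefl]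
        rw [this]; simp [mul_assoc]
      have hle := hmin' c _ (h.conj_move hα hdc.symm)
      have := length_nf_listProd_le (nf (W d) ++ l)
      rw [hW, ← hl] at hle
      simp only [List.length_append, List.length_cons, List.length_nil] at hle this
      omega
  exact ⟨γ, h.mem, h.pres, h.eq, fun v hv => h.map_gen_eq_of_eq_one ⟨v, hv⟩ (hone _)⟩

end LinkClassReduction

/-! ### Induction over link classes. -/

section Main

variable {V : Type*} {Γ : SimpleGraph V} [Finite V] [DecidableEq V]

/-- Take an unfixed i₀ with maximal link: every vertex of strictly larger link is fixed, so its
class can be fixed next. Closure of F under `linkUp` keeps that class disjoint from F, so nothing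
already fixed moves. -/
theorem mem_palGroup_of_fixed (n : ℕ) : ∀ (F : Set V), Fᶜ.ncard ≤ n →
    (∀ v ∈ F, linkUp Γ v ⊆ F) → ∀ α : MulAut (RAAG Γ), α ∈ purePalindromicAut Γ →
    α ∈ linkPreserving Γ → (∀ v ∈ F, α (gen Γ v) = gen Γ v) → α ∈ palGroup Γ := by
  induction n with
  | zero =>
    intro F hF _ α _ _ hfix
    have hF' : F = Set.univ := by
      rw [← Set.compl_empty_iff]
      exact (Set.ncard_eq_zero (Set.toFinite _)).1 (Nat.le_zero.1 hF)
    have : α = 1 := by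
      refine MulEquiv.ext fun x => ?_
      exact DFunLike.congr_fun (f := α.toMonoidHom) (g := MonoidHom.id _)
        (hom_ext fun v => hfix v (hF' ▸ Set.mem_univ v)) x
    rw [this]; exact one_mem _
  | succ n ih =>
    intro F hF hup α hα hp hfix
    rcases Set.eq_empty_or_nonempty Fᶜ with hemp | hne
    · exact ih F (by rw [hemp]; simp) hup α hα hp hfix
    obtain ⟨i₀, hi₀, hmax⟩ := Set.exists_max_image Fᶜ (fun v => (Γ.neighborSet v).ncard)
      (Set.toFinite _) hne
    have hupper : ∀ v ∈ linkUp Γ i₀, Γ.neighborSet v ≠ Γ.neighborSet i₀ → v ∈ F := by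
      intro v hv hvne
      by_contra hvF
      exact hvne (Set.eq_of_subset_of_ncard_le hv (hmax v hvF) (Set.toFinite _)).symm
    obtain ⟨γ, hγ, hγp, hγe, hγf⟩ := exists_fix_linkClass hα hp
      (fun v hv hvne => hfix v (hupper v hv hvne))
    have hclass : ∀ v ∈ F, Γ.neighborSet v ≠ Γ.neighborSet i₀ := fun v hv he =>
      hi₀ (hup v hv (he.subset : Γ.neighborSet v ⊆ Γ.neighborSet i₀))
    have hmem : α * γ ∈ palGroup Γ := by
      refine ih (F ∪ {v | Γ.neighborSet v = Γ.neighborSet i₀}) ?_ ?_ _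
        (mul_mem_purePalindromicAut hα hγ) hγp ?_
      · have : (F ∪ {v | Γ.neighborSet v = Γ.neighborSet i₀})ᶜ.ncard < Fᶜ.ncard := by
          refine Set.ncard_lt_ncard ⟨Set.compl_subset_compl.2 Set.subset_union_left, fun hs => ?_⟩
            (Set.toFinite _)
          exact hs hi₀ (Or.inr rfl)
        omega
      · rintro v (hv | hv) u hu
        · exact Or.inl (hup v hv hu)
        · by_cases hui : Γ.neighborSet u = Γ.neighborSet i₀
          · exact Or.inr hui
          · refine Or.inl (hupper u ?_ hui)
            change Γ.neighborSet i₀ ⊆ _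
            rw [← (hv : Γ.neighborSet v = Γ.neighborSet i₀)]
            exact hu
      · rintro v (hv | hv)
        · rw [hγe v (hclass v hv), hfix v hv]
        · exact hγf v hv
    exact (Subgroup.mul_mem_cancel_right _ hγ).1 hmem

theorem purePalindromicAut_subset_palGroup {α : MulAut (RAAG Γ)}
    (hα : α ∈ purePalindromicAut Γ) : α ∈ palGroup Γ := by
  obtain ⟨γ, hγ, hc⟩ := exists_clean (purePalindromicAut_subset_levelTwo hα)
  have hαγ := mul_mem_purePalindromicAut hα hγ
  have := mem_palGroup_of_fixed _ ∅ le_rfl (by simp) _ hαγ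
    (mem_linkPreserving_of_clean (purePalindromicAut_subset_levelTwo hαγ) hc) (by simp)
  exact (Subgroup.mul_mem_cancel_right _ hγ).1 this

end Main

end RAAG

theorem theorem3p7 {V : Type*} [Finite V] [DecidableEq V] (Γ : SimpleGraph V) :
    (RAAG.inversions Γ ∪ RAAG.elementaryPalindromics Γ).Finite ∧
      ((Subgroup.closure (RAAG.inversions Γ ∪ RAAG.elementaryPalindromics Γ) :
          Subgroup (MulAut (RAAG Γ))) : Set (MulAut (RAAG Γ))) =
        RAAG.purePalindromicAut Γ :=
  ⟨RAAG.finite_generators, Set.Subset.antisymm RAAG.palGroup_subset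
    fun _ h => RAAG.purePalindromicAut_subset_palGroup h⟩
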